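/- Let $K=\mathbb R$ or $K=\mathbb C$. Let $x_{ij}=x_{ji}$ ($i,j\in\{1,2,3,4\}$, $i\ne j$) be six variables, and for pairwise distinct $i,j,k\in\{1,2,3,4\}$ let there be given (formal or convergent) power series over $K$ $$T_k x_{ij}=T_kx_{ji}=x_{ij}+\sum_{m\ge 2}A^{(m)}_{ij;k}(x_{ij},x_{ik},x_{jk}),$$ where $A^{(m)}_{ij;k}$ is a homogeneous polynomial of degree $m$ and $A^{(2)}_{ij;k}=x_{ik}x_{jk}$. They define the maps $\Phi_{ijk}:(x_{ij},x_{ik},x_{jk})\mapsto (T_kx_{ij},T_jx_{ik},T_ix_{jk})$. Let $T_\ell(T_kx_{ij})$ denote the series obtained from $T_kx_{ij}$ by replacing $x_{ij},x_{ik},x_{jk}$ with $T_\ell x_{ij},T_\ell x_{ik},T_\ell x_{jk}$, and suppose that the system is 4D consistent, i.e. $T_\ell(T_kx_{ij})=T_k(T_\ell x_{ij})$ identically in the six variables whenever $\{i,j,k,\ell\}=\{1,2,3,4\}$. Then the system is equivalent, modulo point transformations, to the symmetric discrete Darboux system: there are power series $$g_{ij}(t)=g_{ji}(t)=t+\sum_{m\ge2}b^{(m)}_{ij}t^m\qquad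 (i,j\in\{1,2,3,4\},\ i\neq j)$$ over $K$ such that in the new variables $y_{ij}=g_{ij}(x_{ij})$ the system becomes $$T_ky_{ij}=\frac{y_{ij}+y_{ik}y_{jk}}{\sqrt{1-y_{ik}^2}\,\sqrt{1-y_{jk}^2}},$$ that is, for all pairwise distinct $i,j,k$, as formal power series in $x_{ij},x_{ik},x_{jk}$, $$g_{ij}(T_kx_{ij})=\frac{g_{ij}(x_{ij})+g_{ik}(x_{ik})\,g_{jk}(x_{jk})}{\sqrt{1-g_{ik}(x_{ik})^2}\,\sqrt{1-g_{jk}(x_{jk})^2}},$$ where $\sqrt{1-t^2}=1-\tfrac12t^2-\cdots$ is the binomial series. If all the series $T_kx_{ij}$ are convergent (near the origin), then the series $g_{ij}$ can be chosen convergent as well. -/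

import Mathlib

noncomputable section

namespace Darboux4D

open MvPowerSeries

/-- A family of formal power series `T i j k` in three variables, one for every triple of
directions `i, j, k ∈ {1, 2, 3, 4}` (here `Fin 4`). Only the values at pairwise distinct
`i, j, k` are ever used; there the series `T i j k` expresses the shifted field `T_k x_{ij}`
through `X 0 = x_{ij}`, `X 1 = x_{ik}`, `X 2 = x_{jk}`. The map `Φ_{ijk}` sends
`(x_{ij}, x_{ik}, x_{jk})` to `(T_k x_{ij}, T_j x_{ik}, T_i x_{jk})`, so the family encodes all
four maps `Φ_{123}, Φ_{124}, Φ_{134}, Φ_{234}`. -/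
abbrev MapFamily (K : Type*) := Fin 4 → Fin 4 → Fin 4 → MvPowerSeries (Fin 3) K

section Maps

variable {K : Type*} [CommRing K]

/-- The maps are of the form `T_k x_{ij} = x_{ij} + ∑_{m ≥ 2} A^{(m)}_{ij;k}(x_{ij}, x_{ik}, x_{jk})`
with `A^{(m)}_{ij;k}` homogeneous of degree `m`, and `T_k x_{ij} = T_k x_{ji}`. -/
structure IsNearIdentity (T : MapFamily K) : Prop where
  symm : ∀ i j k, [i, j, k].Nodup → T j i k = rename (Equiv.swap (1 : Fin 3) 2) (T i j k)
  degree_zero : ∀ i j k, [i, j, k].Nodup → homogeneousComponent 0 (T i j k) = 0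
  degree_one : ∀ i j k, [i, j, k].Nodup → homogeneousComponent 1 (T i j k) = X 0

/-- The quadratic part is `A^{(2)}_{ij;k} = x_{ik} x_{jk}`. -/
def HasNormalQuadraticPart (T : MapFamily K) : Prop :=
  ∀ i j k, [i, j, k].Nodup → homogeneousComponent 2 (T i j k) = X 1 * X 2

/-- The initial datum `x_{ij} = x_{ji}` on the square spanned by the directions `i ≠ j`. The
variables are indexed by unordered pairs; the pairs `s(i, i)` never occur. -/
def faceVar (K : Type*) [CommRing K] (i j : Fin 4) : MvPowerSeries (Sym2 (Fin 4)) K := X s(i, j)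

/-- `T_k x_{ij}` as a series in the initial data. -/
def shift (T : MapFamily K) (k i j : Fin 4) : MvPowerSeries (Sym2 (Fin 4)) K :=
  (T i j k).subst ![faceVar K i j, faceVar K i k, faceVar K j k]

/-- `T_ℓ (T_k x_{ij})` as a series in the initial data: the map `T_k x_{ij}` is applied to the
fields shifted in the direction `ℓ`. -/
def shiftShift (T : MapFamily K) (l k i j : Fin 4) : MvPowerSeries (Sym2 (Fin 4)) K :=
  (T i j k).subst ![shift T l i j, shift T l i k, shift T l j k]

/-- 4D consistency: `T_ℓ (T_k x_{ij}) = T_k (T_ℓ x_{ij})` identically in the six initial data,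
whenever `{i, j, k, ℓ} = {1, 2, 3, 4}`. -/
def IsConsistent (T : MapFamily K) : Prop :=
  ∀ i j k l, [i, j, k, l].Nodup → shiftShift T l k i j = shiftShift T k l i j

/-- A point transformation `x_{ij} ↦ g_{ij}(x_{ij}) = x_{ij} + ∑_{m ≥ 2} b_{ij}^{(m)} x_{ij}^m`. -/
def IsPointTransformation (g : Sym2 (Fin 4) → PowerSeries K) : Prop :=
  ∀ i j, i ≠ j → (g s(i, j)).coeff 0 = 0 ∧ (g s(i, j)).coeff 1 = 1

/-- The change of variables `y_{ij} = g_{ij}(x_{ij})` turns the maps `T` into the maps `T'`: if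
`T_k x_{ij} = T i j k (x_{ij}, x_{ik}, x_{jk})`, then
`g_{ij} (T_k x_{ij}) = T' i j k (g_{ij}(x_{ij}), g_{ik}(x_{ik}), g_{jk}(x_{jk}))`. -/
def Transforms (g : Sym2 (Fin 4) → PowerSeries K) (T T' : MapFamily K) : Prop :=
  ∀ i j k, [i, j, k].Nodup →
    (g s(i, j)).subst (T i j k) =
      (T' i j k).subst
        (![(g s(i, j)).subst (X 0 : MvPowerSeries (Fin 3) K),
           (g s(i, k)).subst (X 1 : MvPowerSeries (Fin 3) K),
           (g s(j, k)).subst (X 2 : MvPowerSeries (Fin 3) K)])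

end Maps

section Darboux

variable (K : Type*) [Field K]

theorem hasSubst_neg_sq (v : Fin 3) :
    PowerSeries.HasSubst (-(X v) ^ 2 : MvPowerSeries (Fin 3) K) :=
  PowerSeries.HasSubst.of_constantCoeff_zero (by simp)

variable [CharZero K]

/-- The formal series of `√(1 - v²)`: the binomial series of `(1 + t)^{1/2}` at `t = -v²`. -/
def sqrtOneSubSq (v : Fin 3) : MvPowerSeries (Fin 3) K :=
  (PowerSeries.binomialSeries K (1 / 2 : ℚ)).subst (-(X v) ^ 2 : MvPowerSeries (Fin 3) K)

theorem sqrtOneSubSq_sq (v : Fin 3) : sqrtOneSubSq K v ^ 2 = 1 - X v ^ 2 := by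
  have h : PowerSeries.binomialSeries K (1 / 2 : ℚ) ^ 2 = 1 + PowerSeries.X := by
    rw [pow_two, ← PowerSeries.binomialSeries_add]
    have := PowerSeries.binomialSeries_nat (R := ℚ) (A := K) 1
    norm_num at this ⊢
    exact this
  rw [sqrtOneSubSq, ← PowerSeries.subst_pow (hasSubst_neg_sq K v), h,
    ← PowerSeries.coe_substAlgHom (hasSubst_neg_sq K v), map_add, map_one,
    PowerSeries.coe_substAlgHom, PowerSeries.subst_X (hasSubst_neg_sq K v), sub_eq_add_neg]

theorem constantCoeff_sqrtOneSubSq (v : Fin 3) : constantCoeff (sqrtOneSubSq K v) = 1 := by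
  rw [sqrtOneSubSq, PowerSeries.constantCoeff_subst (hasSubst_neg_sq K v), finsum_eq_single _ 0]
  · simp
  · intro n hn
    simp [hn]

/-- The symmetric discrete Darboux system
`T_k x_{ij} = (x_{ij} + x_{ik} x_{jk}) / (√(1 - x_{ik}²) √(1 - x_{jk}²))`. -/
def darbouxSystem : MapFamily K := fun _ _ _ =>
  (X 0 + X 1 * X 2) * (sqrtOneSubSq K 1)⁻¹ * (sqrtOneSubSq K 2)⁻¹

end Darboux

section Convergence

/-- A power series in finitely many variables is convergent if it converges absolutely on some
polydisc of positive radius. -/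
def IsConvergent {K σ : Type*} [RCLike K] (f : MvPowerSeries σ K) : Prop :=
  ∃ ρ : ℝ, 0 < ρ ∧ Summable fun d : σ →₀ ℕ => ‖coeff d f‖ * ρ ^ d.degree

end Convergence

end Darboux4D

end

/-! An explicit choice of `g` is made at once, and the transformed maps are then shown to coincide
with the Darboux system degree by degree. Let φ_ij(t) = ∑ aₙ tⁿ, where aₙ is the coefficient of
x_ijⁿ x_ik x_jk in T_k x_ij for one chosen k, and let g_ij' = 1/φ_ij, g_ij(0) = 0. If the maps
converge, so do the reciprocal of φ_ij and its primitive g_ij.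

Let E_ijk = g_ij(T_k x_ij) − Darboux(g_ij, g_ik, g_jk), the `defect`. By induction on m, starting
from m = 3, it has order at least m. Both T and the Darboux system (`darbouxAt_consistent`) are 4D
consistent. Comparing the two conditions shows that, modulo degree m + 2, E_ijl(x_ij, x_il, x_jl) +
x_jk E_ikl + x_ik E_jkl + E_ijk(x_ij + x_il x_jl, x_ik + x_il x_kl, x_jk + x_jl x_kl) is invariant
under the exchange of k and l (`IsConsistent.linearizedShift_defect_sub_mem`). In degree m this is a
tautology; degree m + 1, where the quadratic part of the maps acts, carries the information.

Comparing coefficients there shows that the coefficient of x_ij^(m-2) x_ik x_jk does not depend on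
k. This is the freedom of a point transformation, and the choice of g makes it vanish for one k
(`coeff₃_defect_eq_zero`). All other coefficients of degree m are then forced to vanish, so the
order is at least m + 1 (`IsLinearizedSolution.order_succ`). -/

noncomputable section

namespace Darboux4D

open MvPowerSeries

/-! ### Ideals of truncation, and substitution modulo them. -/

section Ideals

variable {σ τ R : Type*} [CommRing R]

/-- The ideal of all power series whose coefficients vanish on a lower set of exponents. -/
def lowerSetIdeal (R : Type*) [CommRing R] (D : LowerSet (σ →₀ ℕ)) : Ideal (MvPowerSeries σ R) where
  carrier := {f | ∀ d ∈ D, coeff d f = 0}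
  zero_mem' := fun _ _ => by simp
  add_mem' := fun {f g} hf hg d hd => by simp [hf d hd, hg d hd]
  smul_mem' := fun f g hg d hd => by
    classical
    rw [smul_eq_mul, coeff_mul]
    refine Finset.sum_eq_zero fun x hx => ?_
    rw [hg x.2 (D.lower (Finset.HasAntidiagonal.mem_antidiagonal.1 hx ▸ le_add_self) hd), mul_zero]

/-- The exponents of total degree less than `n`. -/
def degreeLT (σ : Type*) (n : ℕ) : LowerSet (σ →₀ ℕ) where
  carrier := {d | d.degree < n}
  lower' := fun _ _ h hd => (Finsupp.degree_mono h).trans_lt hd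

/-- The ideal of all power series of order at least `n`. -/
def orderIdeal (σ R : Type*) [CommRing R] (n : ℕ) : Ideal (MvPowerSeries σ R) :=
  lowerSetIdeal R (degreeLT σ n)

theorem orderIdeal_anti {m n : ℕ} (h : m ≤ n) : orderIdeal σ R n ≤ orderIdeal σ R m :=
  fun _ hf d hd => hf d (lt_of_lt_of_le hd h)

theorem mul_mem_orderIdeal {m n : ℕ} {f g : MvPowerSeries σ R} (hf : f ∈ orderIdeal σ R m)
    (hg : g ∈ orderIdeal σ R n) : f * g ∈ orderIdeal σ R (m + n) := by
  classical
  intro d hd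
  rw [coeff_mul]
  refine Finset.sum_eq_zero fun x hx => ?_
  rw [Finset.HasAntidiagonal.mem_antidiagonal] at hx
  have hd' : d.degree < m + n := hd
  rw [← hx, map_add] at hd'
  rcases lt_or_ge x.1.degree m with h | h
  · rw [hf x.1 h, zero_mul]
  · rw [hg x.2 (show x.2.degree < n by omega), mul_zero]

theorem X_mem_orderIdeal (s : σ) : (X s : MvPowerSeries σ R) ∈ orderIdeal σ R 1 := by
  intro d hd
  have : d = 0 := (Finsupp.degree_eq_zero_iff d).1 (Nat.lt_one_iff.mp hd)
  simp [this]

theorem mem_orderIdeal_one {f : MvPowerSeries σ R} :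
    f ∈ orderIdeal σ R 1 ↔ constantCoeff f = 0 := by
  constructor
  · intro h
    rw [← coeff_zero_eq_constantCoeff_apply]
    exact h 0 (by change Finsupp.degree (0 : σ →₀ ℕ) < 1; simp)
  · intro h d hd
    have : d = 0 := (Finsupp.degree_eq_zero_iff d).1 (Nat.lt_one_iff.mp hd)
    rw [this, coeff_zero_eq_constantCoeff_apply, h]

theorem mem_orderIdeal_zero (f : MvPowerSeries σ R) : f ∈ orderIdeal σ R 0 :=
  fun _ hd => absurd hd (Nat.not_lt_zero _)

/-- Two series of order at least `k` which differ by a series of order at least `k + r`. -/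
def Near (r k : ℕ) (x y : MvPowerSeries σ R) : Prop :=
  x ∈ orderIdeal σ R k ∧ y ∈ orderIdeal σ R k ∧ x - y ∈ orderIdeal σ R (k + r)

theorem Near.one (r : ℕ) : Near r 0 (1 : MvPowerSeries σ R) 1 :=
  ⟨mem_orderIdeal_zero _, mem_orderIdeal_zero _, by simp⟩

theorem Near.mul {r k l : ℕ} {x y z w : MvPowerSeries σ R} (h : Near r k x y)
    (h' : Near r l z w) : Near r (k + l) (x * z) (y * w) := by
  refine ⟨mul_mem_orderIdeal h.1 h'.1, mul_mem_orderIdeal h.2.1 h'.2.1, ?_⟩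
  have e : x * z - y * w = (x - y) * z + y * (z - w) := by ring
  rw [e]
  refine add_mem ?_ ?_
  · have := mul_mem_orderIdeal h.2.2 h'.1
    rwa [show k + r + l = k + l + r by ring] at this
  · have := mul_mem_orderIdeal h.2.1 h'.2.2
    rwa [← add_assoc] at this

theorem Near.pow {r : ℕ} {x y : MvPowerSeries σ R} (h : Near r 1 x y) (n : ℕ) :
    Near r n (x ^ n) (y ^ n) := by
  induction n with
  | zero => simpa using Near.one r
  | succ n ih => rw [pow_succ, pow_succ]; exact ih.mul h

theorem Near.prod_pow {r : ℕ} {a b : τ → MvPowerSeries σ R} (h : ∀ s, Near r 1 (a s) (b s))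
    (n : τ →₀ ℕ) : Near r n.degree (n.prod fun s e => a s ^ e) (n.prod fun s e => b s ^ e) := by
  classical
  rw [Finsupp.prod, Finsupp.prod, Finsupp.degree_apply]
  induction n.support using Finset.induction_on with
  | empty => simpa using Near.one r
  | insert s S hs ih =>
    rw [Finset.prod_insert hs, Finset.prod_insert hs, Finset.sum_insert hs]
    exact ((h s).pow _).mul ih

theorem hasSubst_of_mem [Finite τ] {a : τ → MvPowerSeries σ R} (ha : ∀ s, a s ∈ orderIdeal σ R 1) :
    HasSubst a :=
  hasSubst_of_constantCoeff_zero fun s => mem_orderIdeal_one.1 (ha s)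

/-- Congruent arguments give congruent monomials in the quotient ring, and membership in the ideal
is tested one coefficient at a time, so no limit argument is needed. -/
theorem subst_sub_subst_mem_lowerSetIdeal (D : LowerSet (σ →₀ ℕ)) {a b : τ → MvPowerSeries σ R}
    (ha : HasSubst a) (hb : HasSubst b) (h : ∀ s, a s - b s ∈ lowerSetIdeal R D)
    (F : MvPowerSeries τ R) : F.subst a - F.subst b ∈ lowerSetIdeal R D := by
  intro d hd
  rw [map_sub, coeff_subst ha, coeff_subst hb, sub_eq_zero]
  refine finsum_congr fun n => ?_
  congr 1
  rw [← sub_eq_zero, ← map_sub]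
  suffices (n.prod fun s e => a s ^ e) - (n.prod fun s e => b s ^ e) ∈ lowerSetIdeal R D from
    this d hd
  rw [← Ideal.Quotient.mk_eq_mk_iff_sub_mem, Finsupp.prod, Finsupp.prod, map_prod, map_prod]
  refine Finset.prod_congr rfl fun s _ => ?_
  rw [map_pow, map_pow, (Ideal.Quotient.mk_eq_mk_iff_sub_mem _ _).2 (h s)]

/-- Only monomials of degree at least `m` occur in `F`, and on each of them the gap `r` persists by
`Near.prod_pow`. -/
theorem subst_sub_subst_mem_orderIdeal [Finite τ] {m r : ℕ} {F : MvPowerSeries τ R}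
    (hF : F ∈ orderIdeal τ R m) {a b : τ → MvPowerSeries σ R}
    (ha : ∀ s, a s ∈ orderIdeal σ R 1) (hb : ∀ s, b s ∈ orderIdeal σ R 1)
    (h : ∀ s, a s - b s ∈ orderIdeal σ R (1 + r)) :
    F.subst a - F.subst b ∈ orderIdeal σ R (m + r) := by
  intro d hd
  rw [map_sub, coeff_subst (hasSubst_of_mem ha), coeff_subst (hasSubst_of_mem hb), sub_eq_zero]
  refine finsum_congr fun n => ?_
  rcases lt_or_ge n.degree m with hn | hn
  · rw [hF n hn, zero_smul, zero_smul]
  · congr 1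
    rw [← sub_eq_zero, ← map_sub]
    exact orderIdeal_anti (by omega)
      (Near.prod_pow (fun s => ⟨ha s, hb s, h s⟩) n).2.2 d hd

theorem subst_mem_orderIdeal [Finite τ] {m : ℕ} {F : MvPowerSeries τ R}
    (hF : F ∈ orderIdeal τ R m) {a : τ → MvPowerSeries σ R}
    (ha : ∀ s, a s ∈ orderIdeal σ R 1) : F.subst a ∈ orderIdeal σ R m := by
  intro d hd
  rw [coeff_subst (hasSubst_of_mem ha), finsum_eq_zero_of_forall_eq_zero]
  intro n
  rcases lt_or_ge n.degree m with hn | hn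
  · rw [hF n hn, zero_smul]
  · rw [orderIdeal_anti hn (Near.prod_pow (r := 0) (fun s => ⟨ha s, ha s, by simp⟩) n).1 d hd,
      smul_zero]

end Ideals

/-! ### Substitution into series in one variable. -/

section PowerSeriesSubst

variable {σ R : Type*} [CommRing R]

theorem powerSeries_subst_mem_orderIdeal_one {g : PowerSeries R} (hg : g.coeff 0 = 0)
    {x : MvPowerSeries σ R} (hx : x ∈ orderIdeal σ R 1) : g.subst x ∈ orderIdeal σ R 1 :=
  mem_orderIdeal_one.2 (PowerSeries.constantCoeff_subst_eq_zero (mem_orderIdeal_one.1 hx) _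
    (by simpa using hg))

theorem hasSubst_of_mem_one {x : MvPowerSeries σ R} (hx : x ∈ orderIdeal σ R 1) :
    PowerSeries.HasSubst x :=
  PowerSeries.HasSubst.of_constantCoeff_zero (mem_orderIdeal_one.1 hx)

theorem powerSeries_subst_sub_subst_mem_lowerSetIdeal (D : LowerSet (σ →₀ ℕ))
    {x y : MvPowerSeries σ R} (hx : x ∈ orderIdeal σ R 1) (hy : y ∈ orderIdeal σ R 1)
    (h : x - y ∈ lowerSetIdeal R D) (g : PowerSeries R) :
    g.subst x - g.subst y ∈ lowerSetIdeal R D :=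
  subst_sub_subst_mem_lowerSetIdeal D (hasSubst_of_mem fun _ => hx) (hasSubst_of_mem fun _ => hy)
    (fun _ => h) g

/-- Two quadratic Taylor terms of a series `g(t) = t + …`. -/
theorem powerSeries_subst_sub_mem_orderIdeal_three {g : PowerSeries R} (hg : g.coeff 0 = 0)
    (hg' : g.coeff 1 = 1) {x : MvPowerSeries σ R} (hx : x ∈ orderIdeal σ R 1) :
    g.subst x - (x + C (g.coeff 2) * x ^ 2) ∈ orderIdeal σ R 3 := by
  have hs := hasSubst_of_mem_one hx
  obtain ⟨h, hh⟩ : PowerSeries.X ^ 3 ∣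
      g - (PowerSeries.X + PowerSeries.C (g.coeff 2) * PowerSeries.X ^ 2) := by
    rw [PowerSeries.X_pow_dvd_iff]
    intro m hm
    interval_cases m <;> simp [hg', PowerSeries.coeff_X, PowerSeries.coeff_X_pow]
    · simpa using hg
  have e : g = PowerSeries.X + PowerSeries.C (g.coeff 2) * PowerSeries.X ^ 2 +
      PowerSeries.X ^ 3 * h := by rw [← hh]; ring
  have e' : g.subst x = x + C (g.coeff 2) * x ^ 2 + x ^ 3 * h.subst x := by
    conv_lhs => rw [e]
    rw [PowerSeries.subst_add hs, PowerSeries.subst_add hs, PowerSeries.subst_mul hs,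
      PowerSeries.subst_mul hs, PowerSeries.subst_pow hs, PowerSeries.subst_pow hs,
      PowerSeries.subst_X hs, PowerSeries.subst_C]
  rw [e', add_sub_cancel_left]
  exact Ideal.mul_mem_right _ _ (Near.pow (r := 0) ⟨hx, hx, by simp⟩ 3).1

/-- The linear Taylor term of a series `g(t) = t + …`. -/
theorem powerSeries_subst_sub_mem_orderIdeal_two {g : PowerSeries R} (hg : g.coeff 0 = 0)
    (hg' : g.coeff 1 = 1) {x : MvPowerSeries σ R} (hx : x ∈ orderIdeal σ R 1) :
    g.subst x - x ∈ orderIdeal σ R 2 := by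
  have h := orderIdeal_anti (by norm_num : 2 ≤ 3)
    (powerSeries_subst_sub_mem_orderIdeal_three hg hg' hx)
  have h2 := Ideal.mul_mem_left _ (C (g.coeff 2)) (mul_mem_orderIdeal hx hx)
  convert add_mem h h2 using 1
  ring

end PowerSeriesSubst

/-! ### Coefficients of series in three variables and of their quadratic shifts. -/

section Coefficients

variable {K : Type*} [CommRing K]

/-- The exponent `(p, q, r)`. -/
def exponent (p q r : ℕ) : Fin 3 →₀ ℕ := Finsupp.equivFunOnFinite.symm ![p, q, r]

@[simp] theorem exponent_zero (p q r : ℕ) : exponent p q r 0 = p := rfl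
@[simp] theorem exponent_one (p q r : ℕ) : exponent p q r 1 = q := rfl
@[simp] theorem exponent_two (p q r : ℕ) : exponent p q r 2 = r := rfl

theorem eq_exponent_iff {d : Fin 3 →₀ ℕ} {p q r : ℕ} :
    d = exponent p q r ↔ d 0 = p ∧ d 1 = q ∧ d 2 = r := by
  rw [Finsupp.ext_iff, Fin.forall_fin_succ, Fin.forall_fin_succ, Fin.forall_fin_succ]
  simp

theorem exponent_self (d : Fin 3 →₀ ℕ) : exponent (d 0) (d 1) (d 2) = d :=
  (eq_exponent_iff.2 ⟨rfl, rfl, rfl⟩).symm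

@[simp] theorem degree_exponent (p q r : ℕ) : (exponent p q r).degree = p + q + r := by
  rw [Finsupp.degree_eq_sum, Fin.sum_univ_three]; rfl

theorem le_exponent_iff {d : Fin 3 →₀ ℕ} {p q r : ℕ} :
    d ≤ exponent p q r ↔ d 0 ≤ p ∧ d 1 ≤ q ∧ d 2 ≤ r := by
  rw [Finsupp.le_def, Fin.forall_fin_succ, Fin.forall_fin_succ, Fin.forall_fin_succ]
  simp

/-- The coefficient of `X 0 ^ p * X 1 ^ q * X 2 ^ r`. -/
def coeff₃ (F : MvPowerSeries (Fin 3) K) (p q r : ℕ) : K := coeff (exponent p q r) F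

theorem coeff_eq_coeff₃ (F : MvPowerSeries (Fin 3) K) (d : Fin 3 →₀ ℕ) :
    coeff d F = coeff₃ F (d 0) (d 1) (d 2) := by rw [coeff₃, exponent_self]

theorem coeff₃_eq_zero {m : ℕ} {F : MvPowerSeries (Fin 3) K} (hF : F ∈ orderIdeal (Fin 3) K m)
    {p q r : ℕ} (h : p + q + r < m) : coeff₃ F p q r = 0 :=
  hF _ (by change Finsupp.degree _ < m; simpa using h)

theorem coeff_prod_X_pow (e : Equiv.Perm (Fin 6)) (M : Fin 6 →₀ ℕ) (n : Fin 6 → ℕ) :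
    coeff M (∏ s, (X (e s) : MvPowerSeries (Fin 6) K) ^ n s) =
      if ∀ s, M (e s) = n s then 1 else 0 := by
  classical
  have h : (∏ s, (X (e s) : MvPowerSeries (Fin 6) K) ^ n s) =
      monomial (Finsupp.equivFunOnFinite.symm (n ∘ e.symm)) 1 := by
    rw [monomial_one_eq, Finsupp.prod_fintype _ _ (by simp)]
    refine Fintype.prod_equiv e _ _ fun s => ?_
    simp
  rw [h, coeff_monomial]
  congr 1
  rw [Finsupp.ext_iff, ← e.forall_congr_right]
  simp

/-- The arguments of a map on the three squares `e 0, e 1, e 2` after a shift, to second order. -/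
def quadraticShift (K : Type*) [CommRing K] (e : Equiv.Perm (Fin 6)) :
    Fin 3 → MvPowerSeries (Fin 6) K :=
  ![X (e 0) + X (e 3) * X (e 4), X (e 1) + X (e 3) * X (e 5), X (e 2) + X (e 4) * X (e 5)]

theorem quadraticShift_mem (e : Equiv.Perm (Fin 6)) (s : Fin 3) :
    quadraticShift K e s ∈ orderIdeal (Fin 6) K 1 := by
  fin_cases s <;>
    exact add_mem (X_mem_orderIdeal _) (Ideal.mul_mem_right _ _ (X_mem_orderIdeal _))

/-- Expand the three powers by the binomial theorem. The exponents of `M` at `e 0, e 1, e 2` fix how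
often each quadratic term is chosen, so at most one term contributes. -/
theorem coeff_quadraticShift_prod (e : Equiv.Perm (Fin 6)) (M : Fin 6 →₀ ℕ) (n : Fin 3 →₀ ℕ) :
    coeff M (n.prod fun s k => quadraticShift K e s ^ k) =
      if (M (e 0) ≤ n 0 ∧ M (e 1) ≤ n 1 ∧ M (e 2) ≤ n 2) ∧
          M (e 3) = (n 0 - M (e 0)) + (n 1 - M (e 1)) ∧
          M (e 4) = (n 0 - M (e 0)) + (n 2 - M (e 2)) ∧
          M (e 5) = (n 1 - M (e 1)) + (n 2 - M (e 2)) then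
        ((n 0).choose (M (e 0)) * (n 1).choose (M (e 1)) * (n 2).choose (M (e 2)) : K) else 0 := by
  have key : ∀ i j k : ℕ, coeff M (
      ((X (e 0)) ^ i * (X (e 3) * X (e 4)) ^ (n 0 - i) * ((n 0).choose i : MvPowerSeries _ K)) *
      ((X (e 1)) ^ j * (X (e 3) * X (e 5)) ^ (n 1 - j) * ((n 1).choose j : MvPowerSeries _ K)) *
      ((X (e 2)) ^ k * (X (e 4) * X (e 5)) ^ (n 2 - k) * ((n 2).choose k : MvPowerSeries _ K))) =
      if M (e 0) = i ∧ M (e 1) = j ∧ M (e 2) = k ∧ M (e 3) = (n 0 - i) + (n 1 - j) ∧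
          M (e 4) = (n 0 - i) + (n 2 - k) ∧ M (e 5) = (n 1 - j) + (n 2 - k) then
        ((n 0).choose i * (n 1).choose j * (n 2).choose k : K) else 0 := by
    intro i j k
    have e1 : ((X (e 0)) ^ i * (X (e 3) * X (e 4)) ^ (n 0 - i) *
          ((n 0).choose i : MvPowerSeries (Fin 6) K)) *
        ((X (e 1)) ^ j * (X (e 3) * X (e 5)) ^ (n 1 - j) *
          ((n 1).choose j : MvPowerSeries (Fin 6) K)) *
        ((X (e 2)) ^ k * (X (e 4) * X (e 5)) ^ (n 2 - k) *
          ((n 2).choose k : MvPowerSeries (Fin 6) K)) =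
        C ((n 0).choose i * (n 1).choose j * (n 2).choose k : K) *
          ∏ s, X (e s) ^ (![i, j, k, (n 0 - i) + (n 1 - j), (n 0 - i) + (n 2 - k),
            (n 1 - j) + (n 2 - k)] s) := by
      simp only [Fin.prod_univ_six, map_mul, map_natCast, Matrix.cons_val]
      ring
    rw [e1, coeff_C_mul, coeff_prod_X_pow]
    simp [Fin.forall_fin_succ]
  rw [Finsupp.prod_fintype _ _ (by simp), Fin.prod_univ_three]
  simp only [quadraticShift, Matrix.cons_val, add_pow]
  rw [Finset.sum_mul_sum, Finset.sum_mul, map_sum]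
  simp only [Finset.sum_mul, Finset.mul_sum, map_sum, key]
  by_cases h : M (e 0) ≤ n 0 ∧ M (e 1) ≤ n 1 ∧ M (e 2) ≤ n 2
  · rw [Finset.sum_eq_single_of_mem (M (e 0)) (by simp; omega),
      Finset.sum_eq_single_of_mem (M (e 2)) (by simp; omega),
      Finset.sum_eq_single_of_mem (M (e 1)) (by simp; omega)]
    · simp [h]
    · intro b _ hb
      exact if_neg fun h => hb h.2.1.symm
    · intro b _ hb
      exact Finset.sum_eq_zero fun _ _ => if_neg fun h => hb h.2.2.1.symm
    · intro b _ hb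
      exact Finset.sum_eq_zero fun _ _ => Finset.sum_eq_zero fun _ _ =>
        if_neg fun h => hb h.1.symm
  · rw [if_neg fun h' => h h'.1]
    refine Finset.sum_eq_zero fun i hi => Finset.sum_eq_zero fun j hj =>
      Finset.sum_eq_zero fun k hk => if_neg ?_
    simp only [Finset.mem_range] at hi hj hk
    omega

/-- Here `s, t, w` count the uses of the three quadratic terms. The three equations determine them,
so a single monomial of `F` contributes. -/
theorem coeff_subst_quadraticShift (e : Equiv.Perm (Fin 6)) (M : Fin 6 →₀ ℕ) (s t w : ℕ)
    (h3 : M (e 3) = s + t) (h4 : M (e 4) = s + w) (h5 : M (e 5) = t + w)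
    (F : MvPowerSeries (Fin 3) K) :
    coeff M (F.subst (quadraticShift K e)) =
      ((M (e 0) + s).choose (M (e 0)) * (M (e 1) + t).choose (M (e 1)) *
        (M (e 2) + w).choose (M (e 2))) *
        coeff₃ F (M (e 0) + s) (M (e 1) + t) (M (e 2) + w) := by
  rw [coeff_subst (hasSubst_of_mem (quadraticShift_mem e)),
    finsum_eq_single _ (exponent (M (e 0) + s) (M (e 1) + t) (M (e 2) + w))]
  · rw [coeff_quadraticShift_prod, if_pos, smul_eq_mul, mul_comm, coeff₃]
    · simp
    · simp only [exponent_zero, exponent_one, exponent_two]; omega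
  · intro n hn
    rw [coeff_quadraticShift_prod, if_neg, smul_zero]
    rw [Ne, eq_exponent_iff] at hn
    omega

theorem coeff_subst_quadraticShift_eq_zero (e : Equiv.Perm (Fin 6)) (M : Fin 6 →₀ ℕ)
    (h : ∀ s t w, M (e 3) = s + t → M (e 4) = s + w → M (e 5) ≠ t + w)
    (F : MvPowerSeries (Fin 3) K) : coeff M (F.subst (quadraticShift K e)) = 0 := by
  rw [coeff_subst (hasSubst_of_mem (quadraticShift_mem e)), finsum_eq_zero_of_forall_eq_zero]
  intro n
  rw [coeff_quadraticShift_prod, if_neg, smul_zero]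
  rintro ⟨-, h3, h4, h5⟩
  exact h _ _ _ h3 h4 h5

theorem hasSubst_X_X_X {σ : Type*} (x y z : σ) :
    HasSubst (![X x, X y, X z] : Fin 3 → MvPowerSeries σ K) := by
  refine hasSubst_of_mem fun s => ?_
  fin_cases s <;> exact X_mem_orderIdeal _

theorem coeff_subst_X_X_X (e : Equiv.Perm (Fin 6)) (M : Fin 6 →₀ ℕ)
    (F : MvPowerSeries (Fin 3) K) :
    coeff M (F.subst ![X (e 0), X (e 1), X (e 2)]) =
      if M (e 3) = 0 ∧ M (e 4) = 0 ∧ M (e 5) = 0 then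
        coeff₃ F (M (e 0)) (M (e 1)) (M (e 2)) else 0 := by
  have key : ∀ n : Fin 3 →₀ ℕ, coeff M (n.prod fun s k =>
      (![X (e 0), X (e 1), X (e 2)] : Fin 3 → MvPowerSeries (Fin 6) K) s ^ k) =
      if (M (e 0) = n 0 ∧ M (e 1) = n 1 ∧ M (e 2) = n 2) ∧
        M (e 3) = 0 ∧ M (e 4) = 0 ∧ M (e 5) = 0 then 1 else 0 := by
    intro n
    have := coeff_prod_X_pow (K := K) e M ![n 0, n 1, n 2, 0, 0, 0]
    rw [Finsupp.prod_fintype _ _ (by simp), Fin.prod_univ_three]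
    simp only [Fin.prod_univ_six, Matrix.cons_val, pow_zero, mul_one] at this ⊢
    rw [this]
    simp [Fin.forall_fin_succ, and_assoc]
  rw [coeff_subst (hasSubst_X_X_X _ _ _),
    finsum_eq_single _ (exponent (M (e 0)) (M (e 1)) (M (e 2)))]
  · rw [key]
    simp [coeff₃]
  · intro n hn
    rw [key, if_neg, smul_zero]
    rintro ⟨⟨h0, h1, h2⟩, -⟩
    exact hn (eq_exponent_iff.2 ⟨h0.symm, h1.symm, h2.symm⟩)

end Coefficients

section Nodup

theorem exists_nodup_four : ∀ {i j k : Fin 4}, [i, j, k].Nodup → ∃ l, [i, j, k, l].Nodup := by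
  decide

theorem exists_nodup_three : ∀ {i j : Fin 4}, i ≠ j → ∃ k, [i, j, k].Nodup := by
  decide

end Nodup

/-! ### The linearized consistency condition in coefficients. -/

section LinearizedSystem

variable {K : Type*} [CommRing K]

theorem coeff_X_mul_eq {σ : Type*} (M : σ →₀ ℕ) (s : σ) (F : MvPowerSeries σ K) :
    coeff M (X s * F) = if M s = 0 then 0 else coeff (M - Finsupp.single s 1) F := by
  classical
  rw [X, coeff_monomial_mul, one_mul]
  simp only [Finsupp.single_le_iff]
  split_ifs <;> first | rfl | omega

/-- The exchange of the directions `k` and `l` on the six squares `ij, ik, jk, il, jl, kl`. -/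
def exchangeLast : Equiv.Perm (Fin 6) :=
  ⟨![0, 3, 4, 1, 2, 5], ![0, 3, 4, 1, 2, 5], by decide, by decide⟩

/-- One side of the consistency condition, linearized at the quadratic part of the maps. -/
def linearizedShift (E : MapFamily K) (e : Equiv.Perm (Fin 6)) (i j k l : Fin 4) :
    MvPowerSeries (Fin 6) K :=
  (E i j l).subst ![X (e 0), X (e 3), X (e 4)] +
    X (e 2) * (E i k l).subst ![X (e 1), X (e 3), X (e 5)] +
    X (e 1) * (E j k l).subst ![X (e 2), X (e 4), X (e 5)] +
    (E i j k).subst (quadraticShift K e)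

theorem coeff_linearizedShift (E : MapFamily K) (e : Equiv.Perm (Fin 6)) (i j k l : Fin 4)
    (M : Fin 6 →₀ ℕ) :
    coeff M (linearizedShift E e i j k l) =
      (if M (e 1) = 0 ∧ M (e 2) = 0 ∧ M (e 5) = 0 then
        coeff₃ (E i j l) (M (e 0)) (M (e 3)) (M (e 4)) else 0) +
      (if M (e 2) = 1 ∧ M (e 0) = 0 ∧ M (e 4) = 0 then
        coeff₃ (E i k l) (M (e 1)) (M (e 3)) (M (e 5)) else 0) +
      (if M (e 1) = 1 ∧ M (e 0) = 0 ∧ M (e 3) = 0 then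
        coeff₃ (E j k l) (M (e 2)) (M (e 4)) (M (e 5)) else 0) +
      coeff M ((E i j k).subst (quadraticShift K e)) := by
  -- The permutations bring the squares `ij, il, jl`, then `ik, il, kl`, then `jk, jl, kl` to the
  -- front.
  have h1 := coeff_subst_X_X_X (e * exchangeLast) M (E i j l)
  have h2 := coeff_subst_X_X_X (e * ⟨![1, 3, 5, 0, 2, 4], ![3, 0, 4, 1, 5, 2], by decide,
    by decide⟩) (M - Finsupp.single (e 2) 1) (E i k l)
  have h3 := coeff_subst_X_X_X (e * ⟨![2, 4, 5, 0, 1, 3], ![3, 4, 0, 5, 1, 2], by decide,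
    by decide⟩) (M - Finsupp.single (e 1) 1) (E j k l)
  simp [exchangeLast] at h1 h2 h3
  simp only [linearizedShift, map_add, coeff_X_mul_eq, h1, h2, h3]
  congr 1
  congr 1
  · congr 1
    by_cases h : M (e 2) = 0
    · simp [h]
    · rw [if_neg h]
      congr 1
      rw [eq_iff_iff]
      omega
  · by_cases h : M (e 1) = 0
    · simp [h]
    · rw [if_neg h]
      congr 1
      rw [eq_iff_iff]
      omega

end LinearizedSystem

/-! ### Solving the linearized condition by comparison of coefficients. -/

section LinearizedSolution

variable {K : Type*} [Field K]

/-- A family of maps that solves the consistency condition linearized at the quadratic part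
`x_{ij} + x_{ik} x_{jk}` in the lowest degree `m`. -/
structure IsLinearizedSolution (E : MapFamily K) (m : ℕ) : Prop where
  order : ∀ {i j k}, [i, j, k].Nodup → E i j k ∈ orderIdeal (Fin 3) K m
  symm : ∀ {i j k}, [i, j, k].Nodup → ∀ p q r, coeff₃ (E j i k) p q r = coeff₃ (E i j k) p r q
  consistent : ∀ {i j k l}, [i, j, k, l].Nodup →
    linearizedShift E 1 i j k l - linearizedShift E exchangeLast i j l k ∈
      orderIdeal (Fin 6) K (m + 2)

namespace IsLinearizedSolution

variable {E : MapFamily K} {m : ℕ} {i j k l : Fin 4} (h : IsLinearizedSolution E m)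
include h

/-- The exponents `v` follow the order `ij, ik, jk, il, jl, kl`. Degree `m + 1` is the first in
which the condition is not a tautology. -/
theorem coeff_eq (hn : [i, j, k, l].Nodup) (v : Fin 6 → ℕ)
    (hv : v 0 + v 1 + v 2 + v 3 + v 4 + v 5 = m + 1) :
    coeff (Finsupp.equivFunOnFinite.symm v) (linearizedShift E 1 i j k l) =
      coeff (Finsupp.equivFunOnFinite.symm v) (linearizedShift E exchangeLast i j l k) := by
  rw [← sub_eq_zero, ← map_sub]
  refine h.consistent hn _ ?_
  change Finsupp.degree (Finsupp.equivFunOnFinite.symm v : Fin 6 →₀ ℕ) < m + 2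
  rw [Finsupp.degree_eq_sum, Fin.sum_univ_six]
  simp only [Finsupp.equivFunOnFinite_symm_apply_apply]
  omega

/-- Compare coefficients of x_ij^p x_ik^q x_jk^r x_il x_kl. In `E i j k` the factor x_il x_kl comes
from replacing one of the `q + 1` factors x_ik. -/
theorem coeff_dh (hn : [i, j, k, l].Nodup) {p q r : ℕ} (hd : p + (q + 1) + r = m) :
    (q + 1 : K) * coeff₃ (E i j k) p (q + 1) r +
        (if r = 1 ∧ p = 0 then coeff₃ (E i k l) q 1 1 else 0) =
      (if p = 0 ∧ q = 0 then coeff₃ (E j l k) 0 r 1 else 0) +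
        (if q = 1 ∧ r = 0 then 2 * coeff₃ (E i j l) p 2 0 else 0) +
        (if q = 0 ∧ r = 1 then coeff₃ (E i j l) p 1 1 else 0) := by
  have hijl : [i, j, l].Nodup := by revert hn; simp; tauto
  have key := h.coeff_eq hn ![p, q, r, 1, 0, 1] (by simp; omega)
  rw [coeff_linearizedShift, coeff_linearizedShift,
    coeff_subst_quadraticShift _ _ 0 1 0 (by simp) (by simp) (by simp)] at key
  have quad : coeff (Finsupp.equivFunOnFinite.symm ![p, q, r, 1, 0, 1])
      ((E i j l).subst (quadraticShift K exchangeLast)) =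
        (if q = 1 ∧ r = 0 then 2 * coeff₃ (E i j l) p 2 0 else 0) +
          (if q = 0 ∧ r = 1 then coeff₃ (E i j l) p 1 1 else 0) := by
    -- The factor x_kl comes from one use of x_ik x_kl or x_jk x_kl. Each additional use of x_ik
    -- x_jk pushes the required coefficient of `E i j l` below degree `m`, so only `q + r = 1`
    -- survives.
    by_cases hq : q = r + 1
    · rw [coeff_subst_quadraticShift _ _ r 1 0 (by simpa [exchangeLast] using hq)
        (by simp [exchangeLast]) (by simp [exchangeLast])]
      by_cases hr : r = 0
      · simp [exchangeLast, hr, hq]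
      · simp [exchangeLast, hr, hq, coeff₃_eq_zero (h.order hijl) (show p + r + 2 + 0 < m by omega)]
    · by_cases hr : r = q + 1
      · rw [coeff_subst_quadraticShift _ _ q 0 1 (by simp [exchangeLast])
          (by simpa [exchangeLast] using hr) (by simp [exchangeLast])]
        by_cases hq : q = 0
        · simp [exchangeLast, hr, hq]
        · simp [exchangeLast, hr, hq,
            coeff₃_eq_zero (h.order hijl) (show p + q + 1 + 1 < m by omega)]
      · rw [coeff_subst_quadraticShift_eq_zero _ _ (by simp [exchangeLast]; omega),
          if_neg (by omega), if_neg (by omega), add_zero]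
  rw [quad] at key
  simp [exchangeLast] at key
  linear_combination key

/-- Compare coefficients of x_il x_jl x_kl². One side offers only a quadratic coefficient of `E i j
k`, which vanishes; the other gives this sum. -/
theorem coeff_deh_sq (hm : m = 3) (hn : [i, j, k, l].Nodup) :
    coeff₃ (E i l k) 1 0 2 + coeff₃ (E j l k) 1 0 2 = 0 := by
  have hijk : [i, j, k].Nodup := by revert hn; simp; tauto
  have key := h.coeff_eq hn ![0, 0, 0, 1, 1, 2] (by simp [hm])
  rw [coeff_linearizedShift, coeff_linearizedShift,
    coeff_subst_quadraticShift _ _ 0 1 1 (by simp) (by simp) (by simp),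
    coeff_subst_quadraticShift_eq_zero _ _ (by simp [exchangeLast]; omega)] at key
  simp [exchangeLast, coeff₃_eq_zero (h.order hijk) (show 0 + 1 + 1 < m by omega)] at key
  exact key.symm

variable [CharZero K]

/-- Compare coefficients of x_ij^p x_ik^q x_jk^r x_il x_jl. Replacing one of the `p + 1` factors
x_ij gives the left term. The other side contributes only for `q = r`: for `q = 0` its term cancels
against the one from `E i j l`, and for `q ≥ 2` its degree is too low. -/
theorem coeff_de (hn : [i, j, k, l].Nodup) {p q r : ℕ} (hp : p ≠ 0) (hd : p + 1 + q + r = m)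
    (hqr : ¬(q = 1 ∧ r = 1)) : coeff₃ (E i j k) (p + 1) q r = 0 := by
  have hijl : [i, j, l].Nodup := by revert hn; simp; tauto
  have key := h.coeff_eq hn ![p, q, r, 1, 1, 0] (by simp; omega)
  rw [coeff_linearizedShift, coeff_linearizedShift,
    coeff_subst_quadraticShift _ _ 1 0 0 (by simp) (by simp) (by simp)] at key
  by_cases hq : q = r
  · subst hq
    rw [coeff_subst_quadraticShift _ _ q 0 0 (by simp [exchangeLast]) (by simp [exchangeLast])
      (by simp [exchangeLast])] at key
    simp [exchangeLast, hp] at key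
    by_cases h0 : q = 0
    · subst h0
      simp at key
      rcases key with key | key
      · exact absurd key (Nat.cast_add_one_ne_zero p)
      · exact key
    · rw [coeff₃_eq_zero (h.order hijl) (show p + q + 1 + 1 < m by omega)] at key
      simp [h0] at key
      rcases key with key | key
      · exact absurd key (Nat.cast_add_one_ne_zero p)
      · exact key
  · rw [coeff_subst_quadraticShift_eq_zero _ _ (by
      simp [exchangeLast]; omega)] at key
    simp [exchangeLast, hp] at key
    rw [if_neg (by omega)] at key
    simp at key
    rcases key with key | key
    · exact absurd key (Nat.cast_add_one_ne_zero p)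
    · exact key

variable (hm : 3 ≤ m)
  (hnorm : ∀ i j, i ≠ j → ∃ k, [i, j, k].Nodup ∧ coeff₃ (E i j k) (m - 2) 1 1 = 0)
include hm hnorm

/-- By `coeff_dh` with `q = 0`, `r = 1` this coefficient does not depend on the third direction. -/
theorem coeff_one_one (hn : [i, j, k].Nodup) : coeff₃ (E i j k) (m - 2) 1 1 = 0 := by
  obtain ⟨l, hl, h0⟩ := hnorm i j (by revert hn; simp; tauto)
  by_cases hkl : k = l
  · rwa [hkl]
  · have key := h.coeff_dh (l := l) (k := k) (i := i) (j := j) (p := m - 2) (q := 0) (r := 1)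
      (by revert hn hl; simp; tauto) (by omega)
    simpa [show m - 2 ≠ 0 by omega, h0] using key

theorem coeff_zero_left (hn : [i, j, k].Nodup) {q r : ℕ} (hq : 2 ≤ q) (hd : q + r = m) :
    coeff₃ (E i j k) 0 q r = 0 := by
  obtain ⟨l, hl⟩ := exists_nodup_four hn
  obtain ⟨q, rfl⟩ := Nat.exists_eq_add_of_le' (show 1 ≤ q by omega)
  have key := h.coeff_dh hl (p := 0) (q := q) (r := r) (by omega)
  have h1 : r = 1 → coeff₃ (E i k l) q 1 1 = 0 := fun hr => by
    have := h.coeff_one_one hm hnorm (i := i) (j := k) (k := l) (by revert hl; simp; tauto)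
    rwa [show m - 2 = q by omega] at this
  have h2 : ¬(q = 1 ∧ r = 0) := by omega
  have h3 : ¬(q = 0 ∧ r = 1) := by omega
  rw [if_neg h2, if_neg h3, if_neg (show ¬(0 = 0 ∧ q = 0) by omega),
    ite_eq_right_iff.2 fun hr => h1 hr.1] at key
  simpa [Nat.cast_add_one_ne_zero] using key

/-- Away from `(q, r) = (1, 1)` and `(2, 0)`, all correction terms of `coeff_dh` are absent. -/
theorem coeff_mixed (hn : [i, j, k].Nodup) {p q r : ℕ} (hp : p ≠ 0) (hq : q ≠ 0)
    (hd : p + q + r = m) (h20 : ¬(q = 2 ∧ r = 0)) : coeff₃ (E i j k) p q r = 0 := by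
  by_cases h11 : q = 1 ∧ r = 1
  · obtain ⟨rfl, rfl⟩ := h11
    have := h.coeff_one_one hm hnorm hn
    rwa [show m - 2 = p by omega] at this
  obtain ⟨l, hl⟩ := exists_nodup_four hn
  obtain ⟨q, rfl⟩ := Nat.exists_eq_add_of_le' (show 1 ≤ q by omega)
  have key := h.coeff_dh hl (p := p) (q := q) (r := r) (by omega)
  rw [if_neg (by omega), if_neg (by omega), if_neg (by omega), if_neg (by omega)] at key
  simpa [Nat.cast_add_one_ne_zero] using key

/-- This cubic coefficient escapes both `coeff_mixed` and `coeff_de`. It is a number c_ij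
independent of `k`, and `coeff_deh_sq` gives c_ij + c_ik = 0 for any two of the three directions
other than `i`; three numbers with pairwise sums zero vanish. -/
theorem coeff_one_two_zero (hm3 : m = 3) (hn : [i, j, k].Nodup) :
    coeff₃ (E i j k) 1 2 0 = 0 := by
  subst hm3
  have indep : ∀ {i j k l}, [i, j, k, l].Nodup → coeff₃ (E i j k) 1 2 0 = coeff₃ (E i j l) 1 2 0 := by
    intro i j k l hl
    have key := h.coeff_dh hl (p := 1) (q := 1) (r := 0) (by omega)
    norm_num at key
    exact key
  have antisymm : ∀ {i j k l}, [i, j, k, l].Nodup →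
      coeff₃ (E l i k) 1 2 0 + coeff₃ (E l j k) 1 2 0 = 0 := by
    intro i j k l hl
    rw [h.symm (i := i) (j := l) (by revert hl; simp; tauto),
      h.symm (i := j) (j := l) (by revert hl; simp; tauto)]
    exact h.coeff_deh_sq rfl hl
  obtain ⟨l, hl⟩ := exists_nodup_four hn
  have e1 := antisymm (i := j) (j := k) (k := l) (l := i) (by revert hl; simp; tauto)
  have e2 := antisymm (i := j) (j := l) (k := k) (l := i) (by revert hl; simp; tauto)
  have e3 := antisymm (i := k) (j := l) (k := j) (l := i) (by revert hl; simp; tauto)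
  have i1 := indep hl
  have i2 := indep (i := i) (j := k) (k := l) (l := j) (by revert hl; simp; tauto)
  have i3 := indep (i := i) (j := l) (k := k) (l := j) (by revert hl; simp; tauto)
  linear_combination (e1 + e2 - e3 + i1 - i2 - i3) / 2

/-- A solution of the linearized consistency condition of degree `m ≥ 3` vanishes up to point
transformations. -/
theorem order_succ (hn : [i, j, k].Nodup) : E i j k ∈ orderIdeal (Fin 3) K (m + 1) := by
  have hn' : [j, i, k].Nodup := by revert hn; simp; tauto
  -- Exchanging `i` and `j` swaps `q` and `r`; since `m ≥ 3`, this reduces every exponent to one of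
  -- these.
  have main : ∀ {i j k}, [i, j, k].Nodup → ∀ {p q r : ℕ}, p + q + r = m → (p = 0 → 2 ≤ q) →
      (q ≠ 0 ∨ r = 0) → coeff₃ (E i j k) p q r = 0 := by
    intro i j k hn p q r hd h0 hqr
    obtain ⟨l, hl⟩ := exists_nodup_four hn
    rcases Nat.eq_zero_or_pos p with rfl | hp
    · exact h.coeff_zero_left hm hnorm hn (h0 rfl) (by omega)
    · by_cases hq : q = 0
      · obtain ⟨p, rfl⟩ := Nat.exists_eq_add_of_le' hp
        exact h.coeff_de hl (by omega) (by omega) (by omega)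
      · by_cases h20 : q = 2 ∧ r = 0
        · obtain ⟨rfl, rfl⟩ := h20
          by_cases hp1 : p = 1
          · subst hp1
            exact h.coeff_one_two_zero hm hnorm (by omega) hn
          · obtain ⟨p, rfl⟩ := Nat.exists_eq_add_of_le' hp
            exact h.coeff_de hl (by omega) (by omega) (by omega)
        · exact h.coeff_mixed hm hnorm hn (by omega) hq hd h20
  intro d hd
  have hd' : d.degree < m + 1 := hd
  rw [coeff_eq_coeff₃]
  rw [Finsupp.degree_eq_sum, Fin.sum_univ_three] at hd'
  rcases Nat.lt_succ_iff_lt_or_eq.1 hd' with hlt | heq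
  · exact coeff₃_eq_zero (h.order hn) hlt
  · by_cases hc : (d 0 = 0 → 2 ≤ d 1) ∧ (d 1 ≠ 0 ∨ d 2 = 0)
    · exact main hn heq hc.1 hc.2
    · rw [h.symm hn']
      exact main hn' (by omega) (by omega) (by omega)

end IsLinearizedSolution

end LinearizedSolution

/-! ### The Darboux map and its 4D consistency. -/

section DarbouxSeries

variable {σ K : Type*} [Field K]

theorem cons_mem_orderIdeal {n : ℕ} {α β γ : MvPowerSeries σ K} (hα : α ∈ orderIdeal σ K n)
    (hβ : β ∈ orderIdeal σ K n) (hγ : γ ∈ orderIdeal σ K n) (s : Fin 3) :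
    (![α, β, γ] : Fin 3 → MvPowerSeries σ K) s ∈ orderIdeal σ K n := by
  fin_cases s <;> assumption

theorem cons_sub_cons_mem {I : Ideal (MvPowerSeries σ K)} {α β γ α' β' γ' : MvPowerSeries σ K}
    (hα : α - α' ∈ I) (hβ : β - β' ∈ I) (hγ : γ - γ' ∈ I) (s : Fin 3) :
    (![α, β, γ] : Fin 3 → MvPowerSeries σ K) s - (![α', β', γ'] : Fin 3 → _) s ∈ I := by
  fin_cases s <;> assumption

variable [CharZero K]

/-- The root of `1 - y²` with constant coefficient `1`. -/
def IsRootOneSubSq (y u : MvPowerSeries σ K) : Prop :=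
  constantCoeff u = 1 ∧ u ^ 2 = 1 - y ^ 2

theorem eq_of_sq_eq_sq_of_constantCoeff {u v : MvPowerSeries σ K} (hu : constantCoeff u = 1)
    (hv : constantCoeff v = 1) (h : u ^ 2 = v ^ 2) : u = v := by
  rcases sq_eq_sq_iff_eq_or_eq_neg.1 h with h | h
  · exact h
  · have := congrArg constantCoeff h
    rw [map_neg, hu, hv] at this
    norm_num at this

variable (K) in
/-- The common formula of all maps of the symmetric discrete Darboux system. -/
def darboux : MvPowerSeries (Fin 3) K :=
  (X 0 + X 1 * X 2) * (sqrtOneSubSq K 1)⁻¹ * (sqrtOneSubSq K 2)⁻¹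

theorem sqrtOneSubSq_mul_inv (v : Fin 3) : sqrtOneSubSq K v * (sqrtOneSubSq K v)⁻¹ = 1 :=
  MvPowerSeries.mul_inv_cancel _ (by rw [constantCoeff_sqrtOneSubSq]; exact one_ne_zero)

theorem darboux_mul_sqrt :
    darboux K * sqrtOneSubSq K 1 * sqrtOneSubSq K 2 = X 0 + X 1 * X 2 := by
  have h1 := sqrtOneSubSq_mul_inv (K := K) 1
  have h2 := sqrtOneSubSq_mul_inv (K := K) 2
  rw [darboux]
  linear_combination (X 0 + X 1 * X 2) * (sqrtOneSubSq K 2 * (sqrtOneSubSq K 2)⁻¹) * h1 +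
    (X 0 + X 1 * X 2) * h2

theorem sqrtOneSubSq_inv_sub_one_mem (v : Fin 3) :
    (sqrtOneSubSq K v)⁻¹ - 1 ∈ orderIdeal (Fin 3) K 2 := by
  set s := sqrtOneSubSq K v with hs
  have h1 : s * s⁻¹ = 1 := sqrtOneSubSq_mul_inv v
  have h2 : (s + 1) * (s + 1)⁻¹ = 1 := MvPowerSeries.mul_inv_cancel _ (by
    rw [map_add, hs, constantCoeff_sqrtOneSubSq, map_one]; norm_num)
  have h3 : s ^ 2 = 1 - X v ^ 2 := sqrtOneSubSq_sq K v
  -- This is (1 − s)(1 + s) = X², divided by the units s and s + 1.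
  have e : s⁻¹ - 1 = s⁻¹ * (s + 1)⁻¹ * (X v * X v) := by
    linear_combination (s⁻¹ - 1) * (-h2) + h1 * (s + 1)⁻¹ * (s+1) - s⁻¹ * (s + 1)⁻¹ * h3
  rw [e]
  exact Ideal.mul_mem_left _ _ (mul_mem_orderIdeal (X_mem_orderIdeal v) (X_mem_orderIdeal v))

theorem darboux_sub_mem : darboux K - (X 0 + X 1 * X 2) ∈ orderIdeal (Fin 3) K 3 := by
  have h1 := sqrtOneSubSq_inv_sub_one_mem (K := K) 1
  have h2 := sqrtOneSubSq_inv_sub_one_mem (K := K) 2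
  have e : darboux K - (X 0 + X 1 * X 2) = (X 0 + X 1 * X 2) *
      (((sqrtOneSubSq K 1)⁻¹ - 1) * (sqrtOneSubSq K 2)⁻¹ + ((sqrtOneSubSq K 2)⁻¹ - 1)) := by
    rw [darboux]; ring
  rw [e]
  refine mul_mem_orderIdeal (m := 1) (n := 2) ?_ ?_
  · exact add_mem (X_mem_orderIdeal _) (Ideal.mul_mem_right _ _ (X_mem_orderIdeal _))
  · exact add_mem (Ideal.mul_mem_right _ _ h1) h2

theorem darboux_mem : darboux K ∈ orderIdeal (Fin 3) K 1 := by
  have h := add_mem (orderIdeal_anti (by norm_num : 1 ≤ 3) (darboux_sub_mem (K := K)))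
    (add_mem (X_mem_orderIdeal 0) (Ideal.mul_mem_right (X 2) _ (X_mem_orderIdeal (1 : Fin 3))))
  rwa [sub_add_cancel] at h

/-- The Darboux map applied to three series. -/
def darbouxAt (α β γ : MvPowerSeries σ K) : MvPowerSeries σ K := (darboux K).subst ![α, β, γ]

theorem darbouxAt_mem {α β γ : MvPowerSeries σ K} (hα : α ∈ orderIdeal σ K 1)
    (hβ : β ∈ orderIdeal σ K 1) (hγ : γ ∈ orderIdeal σ K 1) :
    darbouxAt α β γ ∈ orderIdeal σ K 1 :=
  subst_mem_orderIdeal darboux_mem (cons_mem_orderIdeal hα hβ hγ)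

theorem isRootOneSubSq_subst {a : Fin 3 → MvPowerSeries σ K} (ha : ∀ s, a s ∈ orderIdeal σ K 1)
    (v : Fin 3) : IsRootOneSubSq (a v) ((sqrtOneSubSq K v).subst a) := by
  have hs := hasSubst_of_mem ha
  have h1 : (1 : MvPowerSeries (Fin 3) K).subst a = 1 := by
    rw [← coe_substAlgHom hs, map_one]
  constructor
  · have h : (sqrtOneSubSq K v - 1).subst a ∈ orderIdeal σ K 1 := by
      refine subst_mem_orderIdeal (mem_orderIdeal_one.2 ?_) ha
      rw [map_sub, constantCoeff_sqrtOneSubSq, map_one, sub_self]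
    rw [mem_orderIdeal_one, subst_sub hs, h1, map_sub, map_one, sub_eq_zero] at h
    exact h
  · rw [← subst_pow hs, sqrtOneSubSq_sq, subst_sub hs, subst_pow hs, subst_X hs, h1]

/-- Clearing denominators turns the Darboux map into polynomial relations between series and roots.
-/
theorem exists_darbouxAt_mul {α β γ : MvPowerSeries σ K} (hα : α ∈ orderIdeal σ K 1)
    (hβ : β ∈ orderIdeal σ K 1) (hγ : γ ∈ orderIdeal σ K 1) :
    ∃ u v, IsRootOneSubSq β u ∧ IsRootOneSubSq γ v ∧ darbouxAt α β γ * u * v = α + β * γ := by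
  have ha := cons_mem_orderIdeal hα hβ hγ
  have hs := hasSubst_of_mem ha
  refine ⟨_, _, isRootOneSubSq_subst ha 1, isRootOneSubSq_subst ha 2, ?_⟩
  rw [darbouxAt, ← subst_mul hs, ← subst_mul hs, darboux_mul_sqrt, subst_add hs, subst_mul hs,
    subst_X hs, subst_X hs, subst_X hs]
  rfl

/-- `P` and `Q` collect the roots in the iterated denominator. The product `P ^ 2 * Q ^ 2` and the
numerator are invariant under the exchange of the last two directions, and so are `P` and `Q`
separately; this yields consistency. -/
theorem exists_darbouxAt_darbouxAt {y : Fin 6 → MvPowerSeries σ K}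
    (hy : ∀ s, y s ∈ orderIdeal σ K 1) :
    ∃ P Q, constantCoeff P = 1 ∧ constantCoeff Q = 1 ∧
      P ^ 2 = 1 - y 1 ^ 2 - y 3 ^ 2 - y 5 ^ 2 - 2 * y 1 * y 3 * y 5 ∧
      Q ^ 2 = 1 - y 2 ^ 2 - y 4 ^ 2 - y 5 ^ 2 - 2 * y 2 * y 4 * y 5 ∧
      darbouxAt (darbouxAt (y 0) (y 3) (y 4)) (darbouxAt (y 1) (y 3) (y 5))
        (darbouxAt (y 2) (y 4) (y 5)) * (P * Q) =
        y 0 * (1 - y 5 ^ 2) + y 3 * y 4 + y 1 * y 2 + y 1 * y 4 * y 5 + y 2 * y 3 * y 5 := by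
  obtain ⟨u3, u4, hu3, hu4, hA⟩ := exists_darbouxAt_mul (hy 0) (hy 3) (hy 4)
  obtain ⟨v3, v5, hv3, hv5, hB⟩ := exists_darbouxAt_mul (hy 1) (hy 3) (hy 5)
  obtain ⟨w4, w5, hw4, hw5, hC⟩ := exists_darbouxAt_mul (hy 2) (hy 4) (hy 5)
  obtain rfl : v3 = u3 := eq_of_sq_eq_sq_of_constantCoeff hv3.1 hu3.1 (hv3.2.trans hu3.2.symm)
  obtain rfl : w4 = u4 := eq_of_sq_eq_sq_of_constantCoeff hw4.1 hu4.1 (hw4.2.trans hu4.2.symm)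
  obtain rfl : w5 = v5 := eq_of_sq_eq_sq_of_constantCoeff hw5.1 hv5.1 (hw5.2.trans hv5.2.symm)
  obtain ⟨b, c, hb, hc, hL⟩ := exists_darbouxAt_mul (darbouxAt_mem (hy 0) (hy 3) (hy 4))
    (darbouxAt_mem (hy 1) (hy 3) (hy 5)) (darbouxAt_mem (hy 2) (hy 4) (hy 5))
  refine ⟨b * v3 * w5, c * w4 * w5, by simp [hb.1, hv3.1, hw5.1], by simp [hc.1, hw4.1, hw5.1],
    ?_, ?_, ?_⟩
  · generalize darbouxAt (y 1) (y 3) (y 5) = B at *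
    have h5 := hw5.2
    have h3 := hv3.2
    have hb := hb.2
    linear_combination v3 ^ 2 * w5 ^ 2 * hb - (B * v3 * w5 + (y 1 + y 3 * y 5)) * hB +
      w5 ^ 2 * h3 + (1 - y 3 ^ 2) * h5
  · generalize darbouxAt (y 2) (y 4) (y 5) = B at *
    have h5 := hw5.2
    have h3 := hw4.2
    have hb := hc.2
    linear_combination w4 ^ 2 * w5 ^ 2 * hb - (B * w4 * w5 + (y 2 + y 4 * y 5)) * hC +
      w5 ^ 2 * h3 + (1 - y 4 ^ 2) * h5
  · have h5 := hw5.2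
    generalize darbouxAt (y 2) (y 4) (y 5) = C at *
    generalize darbouxAt (y 1) (y 3) (y 5) = B at *
    generalize darbouxAt (y 0) (y 3) (y 4) = A at *
    linear_combination v3 * w4 * w5 ^ 2 * hL + w5 ^ 2 * hA + C * w4 * w5 * hB +
      (y 1 + y 3 * y 5) * hC + (y 0 + y 3 * y 4) * h5

/-- The symmetric discrete Darboux system is 4D consistent. -/
theorem darbouxAt_consistent {y : Fin 6 → MvPowerSeries σ K}
    (hy : ∀ s, y s ∈ orderIdeal σ K 1) :
    darbouxAt (darbouxAt (y 0) (y 3) (y 4)) (darbouxAt (y 1) (y 3) (y 5))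
        (darbouxAt (y 2) (y 4) (y 5)) =
      darbouxAt (darbouxAt (y 0) (y 1) (y 2)) (darbouxAt (y 3) (y 1) (y 5))
        (darbouxAt (y 4) (y 2) (y 5)) := by
  obtain ⟨P, Q, hP, hQ, hP2, hQ2, h⟩ := exists_darbouxAt_darbouxAt hy
  obtain ⟨P', Q', hP', hQ', hP2', hQ2', h'⟩ :=
    exists_darbouxAt_darbouxAt (y := y ∘ exchangeLast) fun s => hy _
  simp only [exchangeLast, Equiv.coe_fn_mk, Function.comp_apply, Matrix.cons_val] at hP2' hQ2' h'
  obtain rfl : P = P' := eq_of_sq_eq_sq_of_constantCoeff hP hP' (by rw [hP2, hP2']; ring)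
  obtain rfl : Q = Q' := eq_of_sq_eq_sq_of_constantCoeff hQ hQ' (by rw [hQ2, hQ2']; ring)
  have hPQ : P * Q ≠ 0 := fun h0 => by
    have := congrArg constantCoeff h0
    rw [map_mul, hP, hQ, map_zero] at this
    norm_num at this
  refine mul_right_cancel₀ hPQ ?_
  rw [h, h']
  ring

end DarbouxSeries

/-! ### Consistency in six variables. -/

section Shifts

variable {K : Type*} [CommRing K]

theorem injective_squares : ∀ {i j k l : Fin 4}, [i, j, k, l].Nodup →
    Function.Injective ![s(i, j), s(i, k), s(j, k), s(i, l), s(j, l), s(k, l)] := by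
  decide

/-- The fields on the squares `ij, ik, jk` shifted in the direction `l`, in terms of the data
`X (e 0), …, X (e 5)` on the squares `ij, ik, jk, il, jl, kl`. -/
def shiftedFields (T : MapFamily K) (e : Fin 6 → Fin 6) (i j k l : Fin 4) :
    Fin 3 → MvPowerSeries (Fin 6) K :=
  ![(T i j l).subst ![X (e 0), X (e 3), X (e 4)], (T i k l).subst ![X (e 1), X (e 3), X (e 5)],
    (T j k l).subst ![X (e 2), X (e 4), X (e 5)]]

theorem subst_shift {σ : Type*} (T : MapFamily K) (w : Sym2 (Fin 4) → MvPowerSeries σ K)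
    (hw : ∀ z, w z ∈ orderIdeal σ K 1) (k i j : Fin 4) :
    (shift T k i j).subst w = (T i j k).subst ![w s(i, j), w s(i, k), w s(j, k)] := by
  rw [shift]
  unfold faceVar
  rw [subst_comp_subst_apply (hasSubst_X_X_X _ _ _) (hasSubst_of_mem hw)]
  congr 1
  funext s
  fin_cases s <;> exact subst_X (hasSubst_of_mem hw) _

theorem subst_shiftShift {σ : Type*} (T : MapFamily K)
    (hT : ∀ {i j k}, [i, j, k].Nodup → T i j k ∈ orderIdeal (Fin 3) K 1)
    (w : Sym2 (Fin 4) → MvPowerSeries σ K)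
    (hw : ∀ z, w z ∈ orderIdeal σ K 1) {l k i j : Fin 4} (hn : [i, j, k, l].Nodup) :
    (shiftShift T l k i j).subst w =
      (T i j k).subst ![(T i j l).subst ![w s(i, j), w s(i, l), w s(j, l)],
        (T i k l).subst ![w s(i, k), w s(i, l), w s(k, l)],
        (T j k l).subst ![w s(j, k), w s(j, l), w s(k, l)]] := by
  have hshift : ∀ {i j}, [i, j, l].Nodup → shift T l i j ∈ orderIdeal _ K 1 := fun h =>
    subst_mem_orderIdeal (hT h) fun s => by
      fin_cases s <;> exact X_mem_orderIdeal _
  have h1 : [i, j, l].Nodup := by revert hn; simp; tauto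
  have h2 : [i, k, l].Nodup := by revert hn; simp; tauto
  have h3 : [j, k, l].Nodup := by revert hn; simp
  rw [shiftShift, subst_comp_subst_apply _ (hasSubst_of_mem hw)]
  · congr 1
    funext s
    fin_cases s <;> exact subst_shift T w hw _ _ _
  · refine hasSubst_of_mem fun s => ?_
    fin_cases s
    exacts [hshift h1, hshift h2, hshift h3]

theorem IsConsistent.subst_shiftedFields {T : MapFamily K} (hcons : IsConsistent T)
    (hT : ∀ {i j k}, [i, j, k].Nodup → T i j k ∈ orderIdeal (Fin 3) K 1)
    {i j k l : Fin 4} (hn : [i, j, k, l].Nodup) :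
    (T i j k).subst (shiftedFields T id i j k l) =
      (T i j l).subst (shiftedFields T exchangeLast i j l k) := by
  set v := ![s(i, j), s(i, k), s(j, k), s(i, l), s(j, l), s(k, l)] with hv
  -- Diagonal pairs lie outside the range of `v` and go to an arbitrary variable; they do not occur
  -- in the shifts considered.
  let w : Sym2 (Fin 4) → MvPowerSeries (Fin 6) K := fun z => X (Function.invFun v z)
  have hw : ∀ z, w z ∈ orderIdeal (Fin 6) K 1 := fun z => X_mem_orderIdeal _
  have hwv : ∀ s, w (v s) = X s := fun s => by
    simp only [w]
    rw [Function.leftInverse_invFun (injective_squares hn) s]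
  have h := congrArg (subst w) (hcons i j k l hn)
  rw [subst_shiftShift T hT w hw hn,
    subst_shiftShift T hT w hw (show [i, j, l, k].Nodup by revert hn; simp; tauto),
    Sym2.eq_swap (a := l) (b := k)] at h
  have h0 := hwv 0
  have h1 := hwv 1
  have h2 := hwv 2
  have h3 := hwv 3
  have h4 := hwv 4
  have h5 := hwv 5
  simp only [hv, Matrix.cons_val] at h0 h1 h2 h3 h4 h5
  rw [h0, h1, h2, h3, h4, h5] at h
  exact h

end Shifts

/-! ### The defect of a point transformation. -/

section Defect

variable {K : Type*} [Field K]

theorem subst_sub_quadratic_mem {σ : Type*} {F : MvPowerSeries (Fin 3) K}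
    (hF : F - (X 0 + X 1 * X 2) ∈ orderIdeal (Fin 3) K 3) {a : Fin 3 → MvPowerSeries σ K}
    (ha : ∀ s, a s ∈ orderIdeal σ K 1) :
    F.subst a - (a 0 + a 1 * a 2) ∈ orderIdeal σ K 3 := by
  have hs := hasSubst_of_mem ha
  have h := subst_mem_orderIdeal hF ha
  rwa [subst_sub hs, subst_add hs, subst_mul hs, subst_X hs, subst_X hs, subst_X hs] at h

theorem mem_orderIdeal_one_of_quadratic {F : MvPowerSeries (Fin 3) K}
    (hF : F - (X 0 + X 1 * X 2) ∈ orderIdeal (Fin 3) K 3) : F ∈ orderIdeal (Fin 3) K 1 := by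
  have h := add_mem (orderIdeal_anti (by norm_num : 1 ≤ 3) hF)
    (add_mem (X_mem_orderIdeal 0) (Ideal.mul_mem_right (X 2) _ (X_mem_orderIdeal (1 : Fin 3))))
  rwa [sub_add_cancel] at h

variable [CharZero K]

/-- The failure of the point transformation `g` to turn the maps `T` into the Darboux system. -/
def defect (g : Sym2 (Fin 4) → PowerSeries K) (T : MapFamily K) : MapFamily K := fun i j k =>
  (g s(i, j)).subst (T i j k) - darbouxAt ((g s(i, j)).subst (X 0 : MvPowerSeries (Fin 3) K))
    ((g s(i, k)).subst (X 1 : MvPowerSeries (Fin 3) K))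
    ((g s(j, k)).subst (X 2 : MvPowerSeries (Fin 3) K))

theorem transforms_iff_defect_eq_zero {g : Sym2 (Fin 4) → PowerSeries K} {T : MapFamily K} :
    Transforms g T (darbouxSystem K) ↔ ∀ i j k, [i, j, k].Nodup → defect g T i j k = 0 := by
  refine forall₄_congr fun i j k _ => ?_
  rw [defect, sub_eq_zero]
  rfl

theorem darbouxAt_sub_quadratic_mem {σ : Type*} {α β γ : MvPowerSeries σ K}
    (hα : α ∈ orderIdeal σ K 1) (hβ : β ∈ orderIdeal σ K 1) (hγ : γ ∈ orderIdeal σ K 1) :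
    darbouxAt α β γ - (α + β * γ) ∈ orderIdeal σ K 3 :=
  subst_sub_quadratic_mem darboux_sub_mem (cons_mem_orderIdeal hα hβ hγ)

theorem darbouxAt_sub_mem {σ : Type*} {α β γ x : MvPowerSeries σ K}
    (hα : α ∈ orderIdeal σ K 1) (hβ : β ∈ orderIdeal σ K 1) (hγ : γ ∈ orderIdeal σ K 1)
    (hx : α - x ∈ orderIdeal σ K 2) : darbouxAt α β γ - x ∈ orderIdeal σ K 2 := by
  have h := add_mem (add_mem (orderIdeal_anti (by norm_num : 2 ≤ 3)
    (darbouxAt_sub_quadratic_mem hα hβ hγ)) (mul_mem_orderIdeal hβ hγ)) hx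
  convert h using 1
  ring

/-- The Darboux map to first order in a perturbation of its arguments. -/
theorem darbouxAt_add_sub_mem {σ : Type*} {m : ℕ} (hm : 2 ≤ m)
    {α β γ ε₁ ε₂ ε₃ b c : MvPowerSeries σ K}
    (hα : α ∈ orderIdeal σ K 1) (hβ : β ∈ orderIdeal σ K 1) (hγ : γ ∈ orderIdeal σ K 1)
    (h₁ : ε₁ ∈ orderIdeal σ K m) (h₂ : ε₂ ∈ orderIdeal σ K m) (h₃ : ε₃ ∈ orderIdeal σ K m)
    (hb : β - b ∈ orderIdeal σ K 2) (hc : γ - c ∈ orderIdeal σ K 2) :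
    darbouxAt (α + ε₁) (β + ε₂) (γ + ε₃) - darbouxAt α β γ - (ε₁ + c * ε₂ + b * ε₃) ∈
      orderIdeal σ K (m + 2) := by
  have le : orderIdeal σ K m ≤ orderIdeal σ K 1 := orderIdeal_anti (by omega)
  have ha := cons_mem_orderIdeal hα hβ hγ
  have ha' := cons_mem_orderIdeal (add_mem hα (le h₁)) (add_mem hβ (le h₂)) (add_mem hγ (le h₃))
  -- The part of the Darboux map of order three changes only by order `3 + (m - 1) = m + 2`; the
  -- quadratic part is treated exactly.
  have key := subst_sub_subst_mem_orderIdeal (r := m - 1) (darboux_sub_mem (K := K)) ha' ha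
    (by
      rw [show 1 + (m - 1) = m by omega]
      exact cons_sub_cons_mem (by simpa using h₁) (by simpa using h₂) (by simpa using h₃))
  rw [show 3 + (m - 1) = m + 2 by omega] at key
  have hs := hasSubst_of_mem ha
  have hs' := hasSubst_of_mem ha'
  rw [subst_sub hs, subst_sub hs', subst_add hs, subst_add hs', subst_mul hs, subst_mul hs',
    subst_X hs, subst_X hs, subst_X hs, subst_X hs', subst_X hs', subst_X hs'] at key
  simp only [Matrix.cons_val] at key
  have e1 := mul_mem_orderIdeal h₃ hb
  have e2 := mul_mem_orderIdeal h₂ hc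
  have e3 := orderIdeal_anti (by omega : m + 2 ≤ m + m) (mul_mem_orderIdeal h₂ h₃)
  convert add_mem (add_mem key e1) (add_mem e2 e3) using 1
  rw [darbouxAt, darbouxAt]
  ring

theorem subst_defect {σ : Type*} {g : Sym2 (Fin 4) → PowerSeries K} (hg : IsPointTransformation g)
    {T : MapFamily K} {i j k : Fin 4} (hn : [i, j, k].Nodup)
    (hT : T i j k ∈ orderIdeal (Fin 3) K 1) {a : Fin 3 → MvPowerSeries σ K}
    (ha : ∀ s, a s ∈ orderIdeal σ K 1) :
    (defect g T i j k).subst a = (g s(i, j)).subst ((T i j k).subst a) -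
      darbouxAt ((g s(i, j)).subst (a 0)) ((g s(i, k)).subst (a 1)) ((g s(j, k)).subst (a 2)) := by
  have hs := hasSubst_of_mem ha
  have hij : i ≠ j := by revert hn; simp; tauto
  have hik : i ≠ k := by revert hn; simp; tauto
  have hjk : j ≠ k := by revert hn; simp
  have hgX : ∀ (i j : Fin 4) (s : Fin 3), i ≠ j →
      (g s(i, j)).subst (X s : MvPowerSeries (Fin 3) K) ∈ orderIdeal (Fin 3) K 1 := fun i j s h =>
    powerSeries_subst_mem_orderIdeal_one (hg i j h).1 (X_mem_orderIdeal s)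
  have hcomp : ∀ (f : PowerSeries K) {x : MvPowerSeries (Fin 3) K}, x ∈ orderIdeal (Fin 3) K 1 →
      (f.subst x).subst a = f.subst (x.subst a) := fun f x hx =>
    subst_comp_subst_apply (hasSubst_of_mem fun _ => hx) hs f
  rw [defect, subst_sub hs, hcomp _ hT, darbouxAt, darbouxAt, subst_comp_subst_apply
    (hasSubst_of_mem (cons_mem_orderIdeal (hgX i j 0 hij) (hgX i k 1 hik) (hgX j k 2 hjk))) hs]
  congr 2
  funext s
  fin_cases s
  all_goals
    refine (hcomp _ (X_mem_orderIdeal _)).trans ?_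
    rw [subst_X hs]
    rfl

end Defect

/-! ### The defect solves the linearized condition. -/

section LinearizedConsistency

variable {K : Type*} [Field K] [CharZero K] {g : Sym2 (Fin 4) → PowerSeries K}
  (hg : IsPointTransformation g) {T : MapFamily K}
  (hT : ∀ {i j k}, [i, j, k].Nodup → T i j k - (X 0 + X 1 * X 2) ∈ orderIdeal (Fin 3) K 3)
  {m : ℕ} (hm : 3 ≤ m)
  (hE : ∀ {i j k}, [i, j, k].Nodup → defect g T i j k ∈ orderIdeal (Fin 3) K m)
include hg hT hm hE

/-- Apply `subst_defect` to both shifts. The inner defects pass through the Darboux map to first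
order; the outer one is evaluated at the shifted fields, which differ from `quadraticShift` by order
three. -/
theorem subst_shiftedFields_sub_mem (e : Equiv.Perm (Fin 6)) {i j k l : Fin 4}
    (hn : [i, j, k, l].Nodup) :
    (g s(i, j)).subst ((T i j k).subst (shiftedFields T e i j k l)) -
      darbouxAt
        (darbouxAt ((g s(i, j)).subst (X (e 0) : MvPowerSeries (Fin 6) K))
          ((g s(i, l)).subst (X (e 3) : MvPowerSeries (Fin 6) K))
          ((g s(j, l)).subst (X (e 4) : MvPowerSeries (Fin 6) K)))
        (darbouxAt ((g s(i, k)).subst (X (e 1) : MvPowerSeries (Fin 6) K))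
          ((g s(i, l)).subst (X (e 3) : MvPowerSeries (Fin 6) K))
          ((g s(k, l)).subst (X (e 5) : MvPowerSeries (Fin 6) K)))
        (darbouxAt ((g s(j, k)).subst (X (e 2) : MvPowerSeries (Fin 6) K))
          ((g s(j, l)).subst (X (e 4) : MvPowerSeries (Fin 6) K))
          ((g s(k, l)).subst (X (e 5) : MvPowerSeries (Fin 6) K))) -
      linearizedShift (defect g T) e i j k l ∈ orderIdeal (Fin 6) K (m + 2) := by
  have hijk : [i, j, k].Nodup := by revert hn; simp; tauto
  have hijl : [i, j, l].Nodup := by revert hn; simp; tauto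
  have hikl : [i, k, l].Nodup := by revert hn; simp; tauto
  have hjkl : [j, k, l].Nodup := by revert hn; simp
  have hX : ∀ s : Fin 6, (X s : MvPowerSeries (Fin 6) K) ∈ orderIdeal (Fin 6) K 1 :=
    X_mem_orderIdeal
  have hXs := fun x y z : Fin 6 => cons_mem_orderIdeal (hX x) (hX y) (hX z)
  have hT1 : ∀ {i j k}, [i, j, k].Nodup → T i j k ∈ orderIdeal (Fin 3) K 1 := fun h =>
    mem_orderIdeal_one_of_quadratic (hT h)
  have hgX : ∀ (i j : Fin 4) (s : Fin 6), i ≠ j →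
      (g s(i, j)).subst (X s : MvPowerSeries (Fin 6) K) ∈ orderIdeal (Fin 6) K 1 := fun i j s h =>
    powerSeries_subst_mem_orderIdeal_one (hg i j h).1 (X_mem_orderIdeal s)
  have hgX2 : ∀ (i j : Fin 4) (s : Fin 6), i ≠ j →
      (g s(i, j)).subst (X s : MvPowerSeries (Fin 6) K) - X s ∈ orderIdeal (Fin 6) K 2 :=
    fun i j s h =>
    powerSeries_subst_sub_mem_orderIdeal_two (hg i j h).1 (hg i j h).2 (X_mem_orderIdeal s)
  have hij : i ≠ j := by revert hn; simp; tauto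
  have hik : i ≠ k := by revert hn; simp; tauto
  have hil : i ≠ l := by revert hn; simp; tauto
  have hjk : j ≠ k := by revert hn; simp; tauto
  have hjl : j ≠ l := by revert hn; simp; tauto
  have hkl : k ≠ l := by revert hn; simp
  have hA : ∀ s, shiftedFields T e i j k l s ∈ orderIdeal (Fin 6) K 1 :=
    cons_mem_orderIdeal (subst_mem_orderIdeal (hT1 hijl) (hXs _ _ _))
      (subst_mem_orderIdeal (hT1 hikl) (hXs _ _ _)) (subst_mem_orderIdeal (hT1 hjkl) (hXs _ _ _))
  have hAq : ∀ s, shiftedFields T e i j k l s - quadraticShift K e s ∈ orderIdeal (Fin 6) K 3 :=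
    cons_sub_cons_mem (subst_sub_quadratic_mem (hT hijl) (hXs _ _ _))
      (subst_sub_quadratic_mem (hT hikl) (hXs _ _ _))
      (subst_sub_quadratic_mem (hT hjkl) (hXs _ _ _))
  have h0 := subst_defect hg hijk (hT1 hijk) hA
  have h1 := subst_defect hg hijl (hT1 hijl) (hXs (e 0) (e 3) (e 4))
  have h2 := subst_defect hg hikl (hT1 hikl) (hXs (e 1) (e 3) (e 5))
  have h3 := subst_defect hg hjkl (hT1 hjkl) (hXs (e 2) (e 4) (e 5))
  have key := darbouxAt_add_sub_mem (by omega : 2 ≤ m)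
    (darbouxAt_mem (hgX i j (e 0) hij) (hgX i l (e 3) hil) (hgX j l (e 4) hjl))
    (darbouxAt_mem (hgX i k (e 1) hik) (hgX i l (e 3) hil) (hgX k l (e 5) hkl))
    (darbouxAt_mem (hgX j k (e 2) hjk) (hgX j l (e 4) hjl) (hgX k l (e 5) hkl))
    (subst_mem_orderIdeal (hE hijl) (hXs (e 0) (e 3) (e 4)))
    (subst_mem_orderIdeal (hE hikl) (hXs (e 1) (e 3) (e 5)))
    (subst_mem_orderIdeal (hE hjkl) (hXs (e 2) (e 4) (e 5)))
    (darbouxAt_sub_mem (hgX i k (e 1) hik) (hgX i l (e 3) hil) (hgX k l (e 5) hkl)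
      (hgX2 i k (e 1) hik))
    (darbouxAt_sub_mem (hgX j k (e 2) hjk) (hgX j l (e 4) hjl) (hgX k l (e 5) hkl)
      (hgX2 j k (e 2) hjk))
  have key' := subst_sub_subst_mem_orderIdeal (r := 2) (hE hijk) hA (quadraticShift_mem e) hAq
  simp only [shiftedFields, Matrix.cons_val] at h0 h1 h2 h3 key' ⊢
  rw [← eq_sub_iff_add_eq'.1 h1, ← eq_sub_iff_add_eq'.1 h2, ← eq_sub_iff_add_eq'.1 h3] at h0
  convert add_mem key key' using 1
  rw [linearizedShift, h0]
  ring

theorem IsConsistent.linearizedShift_defect_sub_mem (hcons : IsConsistent T) {i j k l : Fin 4}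
    (hn : [i, j, k, l].Nodup) :
    linearizedShift (defect g T) 1 i j k l - linearizedShift (defect g T) exchangeLast i j l k ∈
      orderIdeal (Fin 6) K (m + 2) := by
  have hn' : [i, j, l, k].Nodup := by revert hn; simp; tauto
  have h1 := subst_shiftedFields_sub_mem hg hT hm hE 1 hn
  have h2 := subst_shiftedFields_sub_mem hg hT hm hE exchangeLast hn'
  have hc := hcons.subst_shiftedFields (fun h => mem_orderIdeal_one_of_quadratic (hT h)) hn
  have hgX : ∀ (i j : Fin 4) (s : Fin 6), i ≠ j →
      (g s(i, j)).subst (X s : MvPowerSeries (Fin 6) K) ∈ orderIdeal (Fin 6) K 1 := fun i j s h =>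
    powerSeries_subst_mem_orderIdeal_one (hg i j h).1 (X_mem_orderIdeal s)
  have hD := darbouxAt_consistent (K := K) (y := fun s =>
    (g (![s(i, j), s(i, k), s(j, k), s(i, l), s(j, l), s(k, l)] s)).subst
      (X s : MvPowerSeries (Fin 6) K)) (fun s => by
        fin_cases s
        · exact hgX i j _ (by revert hn; simp; tauto)
        · exact hgX i k _ (by revert hn; simp; tauto)
        · exact hgX j k _ (by revert hn; simp; tauto)
        · exact hgX i l _ (by revert hn; simp; tauto)
        · exact hgX j l _ (by revert hn; simp; tauto)
        · exact hgX k l _ (by revert hn; simp))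
  simp only [Matrix.cons_val] at hD
  rw [Sym2.eq_swap (a := l) (b := k), ← hc] at h2
  simp only [exchangeLast, Equiv.coe_fn_mk, Matrix.cons_val] at h2
  simp only [Equiv.Perm.coe_one, id_eq] at h1
  rw [hD] at h1
  convert sub_mem h2 h1 using 1
  simp only [exchangeLast]
  ring

end LinearizedConsistency

/-! ### Symmetry of the defect in the first two directions. -/

section Symmetry

variable {K : Type*} [Field K]

theorem coeff₃_rename_swap (F : MvPowerSeries (Fin 3) K) (p q r : ℕ) :
    coeff₃ (rename (Equiv.swap (1 : Fin 3) 2) F) p q r = coeff₃ F p r q := by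
  have h : exponent p q r =
      Finsupp.embDomain (Equiv.swap (1 : Fin 3) 2).toEmbedding (exponent p r q) := by
    rw [eq_comm, eq_exponent_iff]
    refine ⟨?_, ?_, ?_⟩
    · exact Finsupp.embDomain_apply_self (Equiv.swap (1 : Fin 3) 2).toEmbedding _ 0
    · exact Finsupp.embDomain_apply_self (Equiv.swap (1 : Fin 3) 2).toEmbedding _ 2
    · exact Finsupp.embDomain_apply_self (Equiv.swap (1 : Fin 3) 2).toEmbedding _ 1
  rw [coeff₃, coeff₃, h]
  exact coeff_embDomain_rename _ _ _

variable [CharZero K]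

theorem darbouxAt_comm {σ : Type*} {α β γ : MvPowerSeries σ K}
    (hα : α ∈ orderIdeal σ K 1) (hβ : β ∈ orderIdeal σ K 1) (hγ : γ ∈ orderIdeal σ K 1) :
    darbouxAt α β γ = darbouxAt α γ β := by
  obtain ⟨u, v, hu, hv, h⟩ := exists_darbouxAt_mul hα hβ hγ
  obtain ⟨v', u', hv', hu', h'⟩ := exists_darbouxAt_mul hα hγ hβ
  obtain rfl : u = u' := eq_of_sq_eq_sq_of_constantCoeff hu.1 hu'.1 (hu.2.trans hu'.2.symm)
  obtain rfl : v = v' := eq_of_sq_eq_sq_of_constantCoeff hv.1 hv'.1 (hv.2.trans hv'.2.symm)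
  have huv : u * v ≠ 0 := fun h0 => by
    have := congrArg constantCoeff h0
    rw [map_mul, hu.1, hv.1, map_zero] at this
    norm_num at this
  refine mul_right_cancel₀ huv ?_
  linear_combination h - h'

theorem defect_swap {g : Sym2 (Fin 4) → PowerSeries K} (hg : IsPointTransformation g)
    {T : MapFamily K} {i j k : Fin 4} (hn : [i, j, k].Nodup)
    (hT : T i j k ∈ orderIdeal (Fin 3) K 1)
    (hsymm : T j i k = rename (Equiv.swap (1 : Fin 3) 2) (T i j k)) :
    defect g T j i k = rename (Equiv.swap (1 : Fin 3) 2) (defect g T i j k) := by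
  have hgX : ∀ (i j : Fin 4) (s : Fin 3), i ≠ j →
      (g s(i, j)).subst (X s : MvPowerSeries (Fin 3) K) ∈ orderIdeal (Fin 3) K 1 := fun i j s h =>
    powerSeries_subst_mem_orderIdeal_one (hg i j h).1 (X_mem_orderIdeal s)
  rw [rename_eq_subst, subst_defect hg hn hT (a := X ∘ Equiv.swap (1 : Fin 3) 2)
    (fun s => X_mem_orderIdeal _), defect, hsymm,
    rename_eq_subst, Sym2.eq_swap (a := j) (b := i), darbouxAt_comm (hgX i j 0 _)
      (hgX j k 1 _) (hgX i k 2 _)]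
  · rfl
  all_goals revert hn; simp; try tauto

end Symmetry

/-! ### First-order expansions modulo an ideal. -/

section Taylor

variable {σ K : Type*} [Field K]

theorem powerSeries_subst_sub_trunc_mem {g : PowerSeries K} {x : MvPowerSeries σ K}
    (hx : x ∈ orderIdeal σ K 1) (n : ℕ) :
    g.subst x - Polynomial.aeval x (PowerSeries.trunc n g) ∈ orderIdeal σ K n := by
  have hs := hasSubst_of_mem_one hx
  obtain ⟨h, hh⟩ : PowerSeries.X ^ n ∣ g - (PowerSeries.trunc n g : PowerSeries K) := by
    rw [PowerSeries.X_pow_dvd_iff]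
    intro m hm
    rw [map_sub, Polynomial.coeff_coe, PowerSeries.coeff_trunc, if_pos hm, sub_self]
  rw [← PowerSeries.subst_coe hs, ← PowerSeries.subst_sub hs, hh, PowerSeries.subst_mul hs,
    PowerSeries.subst_pow hs, PowerSeries.subst_X hs]
  exact Ideal.mul_mem_right _ _ (Near.pow (r := 0) ⟨hx, hx, by simp⟩ n).1

/-- The linear Taylor formula modulo an ideal that contains the square of the increment. -/
theorem powerSeries_subst_add_sub_mem {I : Ideal (MvPowerSeries σ K)} {n : ℕ}
    (hI : orderIdeal σ K n ≤ I) (g : PowerSeries K) {x w : MvPowerSeries σ K}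
    (hx : x ∈ orderIdeal σ K 1) (hw : w ∈ orderIdeal σ K 1) (hw2 : w ^ 2 ∈ I) :
    g.subst (x + w) - (g.subst x + w * (PowerSeries.derivative K g).subst x) ∈ I := by
  -- Truncating `g` at `n + 1` makes the derivative of the truncation equal to the truncation of the
  -- derivative at `n`.
  have h1 := hI (orderIdeal_anti n.le_succ
    (powerSeries_subst_sub_trunc_mem (g := g) (add_mem hx hw) (n + 1)))
  have h2 := hI (orderIdeal_anti n.le_succ
    (powerSeries_subst_sub_trunc_mem (g := g) hx (n + 1)))
  have h3 := hI (powerSeries_subst_sub_trunc_mem (g := PowerSeries.derivative K g) hx n)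
  have h4 : Polynomial.aeval (x + w) (PowerSeries.trunc (n + 1) g) -
      (Polynomial.aeval x (PowerSeries.trunc (n + 1) g) +
        w * Polynomial.aeval x (PowerSeries.trunc n (PowerSeries.derivative K g))) ∈ I := by
    rw [← Ideal.Quotient.eq_zero_iff_mem, map_sub, map_add, map_mul]
    have hq := Polynomial.aeval_add_of_sq_eq_zero (PowerSeries.trunc (n + 1) g)
      (Ideal.Quotient.mk I x) (Ideal.Quotient.mk I w)
      (by rw [← map_pow]; exact Ideal.Quotient.eq_zero_iff_mem.2 hw2)
    have ha : ∀ (p : Polynomial K) (y : MvPowerSeries σ K), Ideal.Quotient.mk I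
        (Polynomial.aeval y p) = Polynomial.aeval (Ideal.Quotient.mk I y) p := fun p y =>
      (Polynomial.aeval_algHom_apply (Ideal.Quotient.mkₐ K I) y p).symm
    rw [ha, ha, ha, map_add, hq, PowerSeries.trunc_derivative]
    ring
  convert add_mem (sub_mem (sub_mem h1 h2) (Ideal.mul_mem_left _ w h3)) h4 using 1
  ring

theorem powerSeries_subst_sub_mem_of_sq_mem {I : Ideal (MvPowerSeries σ K)} {g : PowerSeries K}
    (hg : g.coeff 0 = 0) (hg' : g.coeff 1 = 1) {x : MvPowerSeries σ K}
    (hx : x ∈ orderIdeal σ K 1) (hI : x ^ 2 ∈ I) : g.subst x - x ∈ I := by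
  have hs := hasSubst_of_mem_one hx
  obtain ⟨h, hh⟩ : PowerSeries.X ^ 2 ∣ g - PowerSeries.X := by
    rw [PowerSeries.X_pow_dvd_iff]
    intro m hm
    interval_cases m
    · simpa using hg
    · simp [hg']
  have e : g.subst x - x = (g - PowerSeries.X).subst x := by
    rw [PowerSeries.subst_sub hs, PowerSeries.subst_X hs]
  rw [e, hh, PowerSeries.subst_mul hs, PowerSeries.subst_pow hs, PowerSeries.subst_X hs]
  exact Ideal.mul_mem_right _ _ hI

theorem exists_powerSeries_subst_eq_X {g : PowerSeries K} (hg : g.coeff 0 = 0)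
    (hg' : g.coeff 1 = 1) : ∃ h : PowerSeries K, h.subst g = (PowerSeries.X : PowerSeries K) :=
  ⟨_, PowerSeries.subst_substInvOfIsUnit_left g (by simpa using hg)
    (by rw [hg']; exact isUnit_one)⟩

/-- Invertible point transformations reflect congruences. -/
theorem sub_mem_of_powerSeries_subst_sub_mem (D : LowerSet (σ →₀ ℕ)) {g : PowerSeries K}
    (hg : g.coeff 0 = 0) (hg' : g.coeff 1 = 1) {x y : MvPowerSeries σ K}
    (hx : x ∈ orderIdeal σ K 1) (hy : y ∈ orderIdeal σ K 1)
    (h : g.subst x - g.subst y ∈ lowerSetIdeal K D) : x - y ∈ lowerSetIdeal K D := by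
  obtain ⟨f, hf⟩ := exists_powerSeries_subst_eq_X hg hg'
  have hcomp : ∀ z : MvPowerSeries σ K, z ∈ orderIdeal σ K 1 → f.subst (g.subst z) = z := by
    intro z hz
    have e := PowerSeries.subst_comp_subst_apply (R := K)
      (PowerSeries.HasSubst.of_constantCoeff_zero' (a := g) (by simpa using hg))
      (hasSubst_of_mem_one hz) f
    rw [← e, hf, PowerSeries.subst_X (hasSubst_of_mem_one hz)]
  have := powerSeries_subst_sub_subst_mem_lowerSetIdeal D
    (powerSeries_subst_mem_orderIdeal_one hg hx) (powerSeries_subst_mem_orderIdeal_one hg hy) h f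
  rwa [hcomp x hx, hcomp y hy] at this

variable [CharZero K]

theorem IsRootOneSubSq.sub_one_mem {I : Ideal (MvPowerSeries σ K)} {y u : MvPowerSeries σ K}
    (hu : IsRootOneSubSq y u) (hI : y ^ 2 ∈ I) : u - 1 ∈ I := by
  have h2 : (u + 1) * (u + 1)⁻¹ = 1 := MvPowerSeries.mul_inv_cancel _ (by
    rw [map_add, hu.1, map_one]; norm_num)
  have e : u - 1 = -(u + 1)⁻¹ * y ^ 2 := by
    linear_combination (1 - u) * h2 + (u + 1)⁻¹ * hu.2
  rw [e]
  exact Ideal.mul_mem_left _ _ hI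

theorem darbouxAt_sub_mem_of_sq_mem {I : Ideal (MvPowerSeries σ K)} {α β γ : MvPowerSeries σ K}
    (hα : α ∈ orderIdeal σ K 1) (hβ : β ∈ orderIdeal σ K 1) (hγ : γ ∈ orderIdeal σ K 1)
    (hβI : β ^ 2 ∈ I) (hγI : γ ^ 2 ∈ I) : darbouxAt α β γ - (α + β * γ) ∈ I := by
  obtain ⟨u, v, hu, hv, h⟩ := exists_darbouxAt_mul hα hβ hγ
  have e : darbouxAt α β γ - (α + β * γ) =
      -(darbouxAt α β γ * v) * (u - 1) - darbouxAt α β γ * (v - 1) := by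
    rw [← h]; ring
  rw [e]
  exact sub_mem (Ideal.mul_mem_left _ _ (hu.sub_one_mem hβI))
    (Ideal.mul_mem_left _ _ (hv.sub_one_mem hγI))

end Taylor

/-! ### The choice of `g` and the mixed coefficient of the defect. -/

section Normalization

variable {K : Type*} [Field K]

theorem X_mul_X_mem_lowerSetIdeal {D : LowerSet (Fin 3 →₀ ℕ)} {s t : Fin 3}
    (h : ∀ d ∈ D, d s = 0 ∨ (d - Finsupp.single s 1 : Fin 3 →₀ ℕ) t = 0) (F : MvPowerSeries (Fin 3) K) :
    X s * (X t * F) ∈ lowerSetIdeal K D := by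
  intro d hd
  rw [coeff_X_mul_eq, coeff_X_mul_eq]
  rcases h d hd with h | h <;> simp [h]

/-- The series `∑ₙ aₙ tⁿ`, where `aₙ` is the coefficient of `X 0 ^ n * X 1 * X 2`. -/
def mixedCoeffs (F : MvPowerSeries (Fin 3) K) : PowerSeries K :=
  PowerSeries.mk fun n => coeff₃ F n 1 1

/-- An exponent in the box below `(N, 1, 1)` either lies in `D`, where `F` agrees with `X 0`, or
equals `(n, 1, 1)`. -/
theorem sub_mixedCoeffs_mem_of_sub_mem (N : ℕ) {F : MvPowerSeries (Fin 3) K}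
    {D : LowerSet (Fin 3 →₀ ℕ)} (hD : ∀ d, d ∈ D ↔ d 0 ≤ N ∧ d 1 + d 2 ≤ 1)
    (hF : F - X 0 ∈ lowerSetIdeal K D) :
    F - (X 0 + X 1 * (X 2 * (mixedCoeffs F).subst (X 0 : MvPowerSeries (Fin 3) K))) ∈
      lowerSetIdeal K (LowerSet.Iic (exponent N 1 1)) := by
  intro d hd
  rw [LowerSet.mem_Iic_iff, le_exponent_iff] at hd
  rw [map_sub, map_add, coeff_X_mul_eq, coeff_X_mul_eq]
  by_cases h : d 1 + d 2 ≤ 1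
  · have h1 := hF d ((hD d).2 ⟨hd.1, h⟩)
    rw [map_sub] at h1
    have h2 : (if d 1 = 0 then 0 else if (d - Finsupp.single 1 1 : Fin 3 →₀ ℕ) 2 = 0 then 0 else
        coeff (d - Finsupp.single 1 1 - Finsupp.single 2 1)
          ((mixedCoeffs F).subst (X 0 : MvPowerSeries (Fin 3) K))) = 0 := by
      by_cases h1 : d 1 = 0
      · simp [h1]
      · rw [if_neg h1, if_pos]
        simp; omega
    rw [h2, add_zero, h1]
  · have e : d = exponent (d 0) 1 1 := eq_exponent_iff.2 ⟨rfl, by omega, by omega⟩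
    have h0 : coeff d (X 0 : MvPowerSeries (Fin 3) K) = 0 := by
      classical
      rw [coeff_X, if_neg]
      intro h
      have := congrArg (· 1) (e.symm.trans h)
      simp at this
    have e' : d - Finsupp.single 1 1 - Finsupp.single 2 1 = Finsupp.single 0 (d 0) := by
      rw [e]
      ext s
      fin_cases s <;> simp
    have h1 : d 1 ≠ 0 := by omega
    have h2 : (d - Finsupp.single 1 1 : Fin 3 →₀ ℕ) 2 ≠ 0 := by simp; omega
    rw [if_neg h1, if_neg h2, h0, zero_add, e', PowerSeries.coeff_subst_single]
    simp only [Finsupp.single_eq_same, if_true, mixedCoeffs, PowerSeries.coeff_mk]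
    rw [coeff₃, ← e, sub_self]

variable [CharZero K]

/-- If `g' = 1 / ∂₂∂₃ T` on the first axis, the mixed coefficient of lowest degree of the defect
vanishes. -/
theorem coeff₃_defect_eq_zero {g : Sym2 (Fin 4) → PowerSeries K} (hg : IsPointTransformation g)
    {T : MapFamily K} {i j k : Fin 4} (hn : [i, j, k].Nodup)
    (hT : T i j k ∈ orderIdeal (Fin 3) K 1)
    (hder : PowerSeries.derivative K (g s(i, j)) * mixedCoeffs (T i j k) = 1) {m : ℕ}
    (hm : 2 ≤ m) (hE : defect g T i j k ∈ orderIdeal (Fin 3) K m) :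
    coeff₃ (defect g T i j k) (m - 2) 1 1 = 0 := by
  have hij : i ≠ j := by revert hn; simp; tauto
  have hik : i ≠ k := by revert hn; simp; tauto
  have hjk : j ≠ k := by revert hn; simp
  have hX := fun s : Fin 3 => X_mem_orderIdeal (R := K) s
  have hgX : ∀ (i j : Fin 4) (s : Fin 3), i ≠ j →
      (g s(i, j)).subst (X s : MvPowerSeries (Fin 3) K) ∈ orderIdeal (Fin 3) K 1 := fun i j s h =>
    powerSeries_subst_mem_orderIdeal_one (hg i j h).1 (hX s)
  have hg0 := (hg i j hij).1
  have hg1 := (hg i j hij).2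
  obtain ⟨D, hD⟩ : ∃ D : LowerSet (Fin 3 →₀ ℕ), ∀ d, d ∈ D ↔ d 0 ≤ m - 2 ∧ d 1 + d 2 ≤ 1 :=
    ⟨⟨{d | d 0 ≤ m - 2 ∧ d 1 + d 2 ≤ 1}, fun a b h ha =>
      ⟨(h 0).trans ha.1, (add_le_add (h 1) (h 2)).trans ha.2⟩⟩, fun d => Iff.rfl⟩
  have hXX : ∀ s t : Fin 3, s ≠ 0 → t ≠ 0 → X s * X t ∈ lowerSetIdeal K D := fun s t hs ht => by
    rw [← mul_one (X t)]
    refine X_mul_X_mem_lowerSetIdeal (fun d hd => ?_) 1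
    rw [hD] at hd
    fin_cases s <;> fin_cases t <;> simp at hs ht ⊢ <;> omega
  have sq_mem : ∀ {I : Ideal (MvPowerSeries (Fin 3) K)} {i j : Fin 4} {s : Fin 3}, i ≠ j →
      X s * X s ∈ I → ((g s(i, j)).subst (X s : MvPowerSeries (Fin 3) K)) ^ 2 ∈ I := by
    intro I i j s h hI
    rw [← PowerSeries.subst_pow (hasSubst_of_mem_one (hX s))]
    obtain ⟨f, hf⟩ : PowerSeries.X ∣ g s(i, j) := by
      rw [PowerSeries.X_dvd_iff]; simpa using (hg i j h).1
    rw [hf, mul_pow, PowerSeries.subst_mul (hasSubst_of_mem_one (hX s)),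
      PowerSeries.subst_pow (hasSubst_of_mem_one (hX s)),
      PowerSeries.subst_X (hasSubst_of_mem_one (hX s)), pow_two]
    exact Ideal.mul_mem_right _ _ hI
  -- Exponents in `D` have degree below `m`, so the defect vanishes there. Modulo this ideal the
  -- Darboux map reduces to its first argument, and `g` can be cancelled.
  have hTX : T i j k - X 0 ∈ lowerSetIdeal K D := by
    refine sub_mem_of_powerSeries_subst_sub_mem D hg0 hg1 hT (hX 0) ?_
    have h1 : defect g T i j k ∈ lowerSetIdeal K D := fun d hd => hE d (by
      rw [hD] at hd
      change d.degree < m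
      rw [Finsupp.degree_eq_sum, Fin.sum_univ_three]
      omega)
    have h2 := darbouxAt_sub_mem_of_sq_mem (hgX i j 0 hij) (hgX i k 1 hik) (hgX j k 2 hjk)
      (sq_mem hik (hXX 1 1 (by decide) (by decide))) (sq_mem hjk (hXX 2 2 (by decide) (by decide)))
    have h3 : (g s(i, k)).subst (X 1 : MvPowerSeries (Fin 3) K) *
        (g s(j, k)).subst (X 2 : MvPowerSeries (Fin 3) K) ∈ lowerSetIdeal K D := by
      have s1 := hasSubst_of_mem_one (hX 1)
      have s2 := hasSubst_of_mem_one (hX 2)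
      obtain ⟨f, hf⟩ : PowerSeries.X ∣ g s(i, k) := by
        rw [PowerSeries.X_dvd_iff]; simpa using (hg i k hik).1
      obtain ⟨f', hf'⟩ : PowerSeries.X ∣ g s(j, k) := by
        rw [PowerSeries.X_dvd_iff]; simpa using (hg j k hjk).1
      rw [hf, hf', PowerSeries.subst_mul s1, PowerSeries.subst_mul s2, PowerSeries.subst_X s1,
        PowerSeries.subst_X s2, mul_mul_mul_comm]
      exact Ideal.mul_mem_right _ _ (hXX 1 2 (by decide) (by decide))
    convert add_mem (add_mem h1 h2) h3 using 1
    rw [defect]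
    ring
  -- Modulo `I` the squares of `X 1` and `X 2` vanish, so g(T) reduces to g(X 0) + W g'(X 0). By
  -- `hder` the last term is `X 1 * X 2`, which is also the product term of the Darboux map.
  set I := lowerSetIdeal K (LowerSet.Iic (exponent (m - 2) 1 1)) with hI
  have hsq : ∀ (s : Fin 3) F, s ≠ 0 → X s * (X s * F) ∈ I := fun s F hs => by
    refine X_mul_X_mem_lowerSetIdeal (fun d hd => ?_) F
    rw [LowerSet.mem_Iic_iff, le_exponent_iff] at hd
    fin_cases s <;> simp at hs ⊢ <;> omega
  have hsq' : ∀ s : Fin 3, s ≠ 0 → X s * X s ∈ I := fun s hs => by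
    simpa using hsq s 1 hs
  have hle : orderIdeal (Fin 3) K (m + 1) ≤ I := fun f hf d hd => hf d (by
    rw [LowerSet.mem_Iic_iff, le_exponent_iff] at hd
    change d.degree < m + 1
    rw [Finsupp.degree_eq_sum, Fin.sum_univ_three]
    omega)
  set W : MvPowerSeries (Fin 3) K :=
    X 1 * (X 2 * (mixedCoeffs (T i j k)).subst (X 0 : MvPowerSeries (Fin 3) K)) with hW
  have hW1 : W ∈ orderIdeal (Fin 3) K 1 := Ideal.mul_mem_right _ _ (hX 1)
  have hW2 : W ^ 2 ∈ I := by
    have e : W ^ 2 = X 1 * (X 1 *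
        (X 2 * (mixedCoeffs (T i j k)).subst (X 0 : MvPowerSeries (Fin 3) K)) ^ 2) := by
      rw [hW]; ring
    rw [e]
    exact hsq 1 _ (by decide)
  have h1 : (g s(i, j)).subst (T i j k) - (g s(i, j)).subst (X 0 + W) ∈ I :=
    powerSeries_subst_sub_subst_mem_lowerSetIdeal _ hT (add_mem (hX 0) hW1)
      (sub_mixedCoeffs_mem_of_sub_mem (m - 2) hD hTX) _
  have h2 := powerSeries_subst_add_sub_mem hle (g s(i, j)) (hX 0) hW1 hW2
  have h3 : W * (PowerSeries.derivative K (g s(i, j))).subst (X 0 : MvPowerSeries (Fin 3) K) =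
      X 1 * X 2 := by
    have s0 := hasSubst_of_mem_one (hX 0)
    have := congrArg (PowerSeries.subst (X 0 : MvPowerSeries (Fin 3) K)) hder
    rw [PowerSeries.subst_mul s0, ← PowerSeries.coe_substAlgHom s0, map_one,
      PowerSeries.coe_substAlgHom s0] at this
    rw [hW]
    linear_combination X 1 * X 2 * this
  have h4 := darbouxAt_sub_mem_of_sq_mem (hgX i j 0 hij) (hgX i k 1 hik) (hgX j k 2 hjk)
    (sq_mem hik (hsq' 1 (by decide))) (sq_mem hjk (hsq' 2 (by decide)))
  have h5 := powerSeries_subst_sub_mem_of_sq_mem (hg i k hik).1 (hg i k hik).2 (hX 1)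
    (by rw [pow_two]; exact hsq' 1 (by decide))
  have h6 := powerSeries_subst_sub_mem_of_sq_mem (hg j k hjk).1 (hg j k hjk).2 (hX 2)
    (by rw [pow_two]; exact hsq' 2 (by decide))
  rw [h3] at h2
  have h7 : defect g T i j k ∈ I := by
    convert sub_mem (sub_mem (add_mem h1 h2) h4) (add_mem (Ideal.mul_mem_right
      ((g s(j, k)).subst (X 2 : MvPowerSeries (Fin 3) K)) I h5) (Ideal.mul_mem_left I (X 1) h6))
      using 1
    rw [defect]
    ring
  exact h7 _ (by rw [LowerSet.mem_Iic_iff])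

/-- The defect has order at least three. -/
theorem defect_mem_orderIdeal_three {g : Sym2 (Fin 4) → PowerSeries K}
    (hg : IsPointTransformation g) {T : MapFamily K} {i j k : Fin 4} (hn : [i, j, k].Nodup)
    (hT : T i j k - (X 0 + X 1 * X 2) ∈ orderIdeal (Fin 3) K 3) :
    defect g T i j k ∈ orderIdeal (Fin 3) K 3 := by
  have hij : i ≠ j := by revert hn; simp; tauto
  have hik : i ≠ k := by revert hn; simp; tauto
  have hjk : j ≠ k := by revert hn; simp
  have hX := fun s : Fin 3 => X_mem_orderIdeal (R := K) s
  have hgX : ∀ (i j : Fin 4) (s : Fin 3), i ≠ j →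
      (g s(i, j)).subst (X s : MvPowerSeries (Fin 3) K) ∈ orderIdeal (Fin 3) K 1 := fun i j s h =>
    powerSeries_subst_mem_orderIdeal_one (hg i j h).1 (hX s)
  have hT1 := mem_orderIdeal_one_of_quadratic hT
  have hT2 : T i j k - X 0 ∈ orderIdeal (Fin 3) K 2 := by
    convert add_mem (orderIdeal_anti (by norm_num : 2 ≤ 3) hT)
      (mul_mem_orderIdeal (hX 1) (hX 2)) using 1
    ring
  have h1 := powerSeries_subst_sub_mem_orderIdeal_three (hg i j hij).1 (hg i j hij).2 hT1
  have h2 := powerSeries_subst_sub_mem_orderIdeal_three (hg i j hij).1 (hg i j hij).2 (hX 0)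
  have h3 := darbouxAt_sub_quadratic_mem (hgX i j 0 hij) (hgX i k 1 hik) (hgX j k 2 hjk)
  have h4 := mul_mem_orderIdeal
    (powerSeries_subst_sub_mem_orderIdeal_two (hg i k hik).1 (hg i k hik).2 (hX 1)) (hgX j k 2 hjk)
  have h5 := mul_mem_orderIdeal (hX 1)
    (powerSeries_subst_sub_mem_orderIdeal_two (hg j k hjk).1 (hg j k hjk).2 (hX 2))
  -- T² − X₀² = (T − X₀)(T + X₀) has order three, so the quadratic coefficient of `g` does not
  -- matter.
  have h6 := Ideal.mul_mem_left _ (C ((g s(i, j)).coeff 2))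
    (mul_mem_orderIdeal hT2 (add_mem hT1 (hX 0)))
  convert sub_mem (sub_mem (sub_mem (add_mem (add_mem h1 hT) h6) h2) h3) (add_mem h4 h5) using 1
  rw [defect]
  ring

end Normalization

/-! ### The formal theorem. -/

section Formal

variable {K : Type*} [Field K]

theorem IsNearIdentity.sub_quadratic_mem {T : MapFamily K} (hT : IsNearIdentity T)
    (hquad : HasNormalQuadraticPart T) {i j k : Fin 4} (hn : [i, j, k].Nodup) :
    T i j k - (X 0 + X 1 * X 2) ∈ orderIdeal (Fin 3) K 3 := by
  classical
  intro d hd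
  have hd' : d.degree < 3 := hd
  have hc : coeff d (homogeneousComponent d.degree (T i j k)) = coeff d (T i j k) := by
    rw [coeff_homogeneousComponent, if_pos rfl]
  have hX : d.degree ≠ 1 → coeff d (X 0 : MvPowerSeries (Fin 3) K) = 0 := fun h => by
    rw [coeff_X, if_neg]
    rintro rfl
    simp at h
  have hXX : d.degree < 2 → coeff d (X 1 * X 2 : MvPowerSeries (Fin 3) K) = 0 := fun h =>
    mul_mem_orderIdeal (X_mem_orderIdeal 1) (X_mem_orderIdeal 2) d h
  rw [map_sub, map_add, ← hc]
  generalize d.degree = n at *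
  interval_cases n
  · rw [hT.degree_zero i j k hn, hX (by norm_num), hXX (by norm_num)]
    simp
  · rw [hT.degree_one i j k hn, hXX (by norm_num)]
    simp
  · rw [hquad i j k hn, hX (by norm_num)]
    simp

theorem coeff_zero_mixedCoeffs {F : MvPowerSeries (Fin 3) K}
    (hF : F - (X 0 + X 1 * X 2) ∈ orderIdeal (Fin 3) K 3) : (mixedCoeffs F).coeff 0 = 1 := by
  classical
  have h := hF (exponent 0 1 1) (by
    change Finsupp.degree _ < 3
    simp)
  have h0 : exponent 0 1 1 ≠ Finsupp.single 0 1 := fun h => by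
    have := congrArg (· 1) h
    simp at this
  have h2 : (exponent 0 1 1 - Finsupp.single 1 1 : Fin 3 →₀ ℕ) = Finsupp.single 2 1 := by
    ext s
    fin_cases s <;> simp
  rw [map_sub, sub_eq_zero] at h
  rw [mixedCoeffs, PowerSeries.coeff_mk, coeff₃, h, map_add, coeff_X, if_neg h0, coeff_X_mul_eq,
    h2, coeff_X]
  simp

variable [CharZero K]

/-- One normalized triple per unordered pair suffices: `coeff_one_one` covers the other third
direction, and symmetry the other order of the pair. -/
theorem transforms_darbouxSystem {T : MapFamily K} (hT : IsNearIdentity T)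
    (hquad : HasNormalQuadraticPart T) (hcons : IsConsistent T)
    {g : Sym2 (Fin 4) → PowerSeries K} (hg : IsPointTransformation g)
    (hder : ∀ i j, i ≠ j → ∃ i' j' k, [i', j', k].Nodup ∧ s(i', j') = s(i, j) ∧
      PowerSeries.derivative K (g s(i', j')) * mixedCoeffs (T i' j' k) = 1) :
    Transforms g T (darbouxSystem K) := by
  have hT3 : ∀ {i j k}, [i, j, k].Nodup → T i j k - (X 0 + X 1 * X 2) ∈ orderIdeal (Fin 3) K 3 :=
    fun h => hT.sub_quadratic_mem hquad h
  have hT1 : ∀ {i j k}, [i, j, k].Nodup → T i j k ∈ orderIdeal (Fin 3) K 1 := fun h =>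
    mem_orderIdeal_one_of_quadratic (hT3 h)
  have hsymm : ∀ {i j k}, [i, j, k].Nodup → ∀ p q r,
      coeff₃ (defect g T j i k) p q r = coeff₃ (defect g T i j k) p r q := by
    intro i j k h p q r
    rw [defect_swap hg h (hT1 h) (hT.symm i j k h), coeff₃_rename_swap]
  have key : ∀ m, 3 ≤ m → ∀ {i j k}, [i, j, k].Nodup →
      defect g T i j k ∈ orderIdeal (Fin 3) K m := by
    intro m hm
    induction m, hm using Nat.le_induction with
    | base => exact fun h => defect_mem_orderIdeal_three hg h (hT3 h)
    | succ m hm ih =>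
      intro i j k hn
      have hsol : IsLinearizedSolution (defect g T) m :=
        ⟨ih, hsymm, fun h => hcons.linearizedShift_defect_sub_mem hg hT3 hm ih h⟩
      refine hsol.order_succ hm (fun i j hij => ?_) hn
      obtain ⟨i', j', k, hn, he, hd⟩ := hder i j hij
      have h0 := coeff₃_defect_eq_zero hg hn (hT1 hn) hd (by omega) (ih hn)
      rcases Sym2.eq_iff.1 he with ⟨rfl, rfl⟩ | ⟨rfl, rfl⟩
      · exact ⟨k, hn, h0⟩
      · exact ⟨k, by revert hn; simp; tauto, (hsymm hn _ _ _).trans h0⟩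
  rw [transforms_iff_defect_eq_zero]
  intro i j k hn
  ext d
  rw [map_zero]
  exact key (d.degree + 3) (by omega) hn d (show d.degree < d.degree + 3 by omega)

/-- The series `g(t) = t + …` with `g' = 1 / φ`. -/
def integralInv (φ : PowerSeries K) : PowerSeries K :=
  PowerSeries.mk fun n => PowerSeries.coeff (n - 1) φ⁻¹ / n

theorem derivative_integralInv_mul {φ : PowerSeries K} (h : φ.coeff 0 = 1) :
    PowerSeries.derivative K (integralInv φ) * φ = 1 := by
  have e : PowerSeries.derivative K (integralInv φ) = φ⁻¹ := by
    ext n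
    rw [PowerSeries.coeff_derivative, integralInv,
      PowerSeries.coeff_mk]
    have : (n + 1 : K) ≠ 0 := Nat.cast_add_one_ne_zero n
    push_cast
    exact div_mul_cancel₀ _ this
  rw [e]
  refine PowerSeries.inv_mul_cancel _ ?_
  rw [← PowerSeries.coeff_zero_eq_constantCoeff_apply, h]
  exact one_ne_zero

/-- At `n = 0` the definition divides by zero, which gives the required value `0`. -/
theorem coeff_zero_integralInv (φ : PowerSeries K) : (integralInv φ).coeff 0 = 0 := by
  simp [integralInv]

theorem coeff_one_integralInv {φ : PowerSeries K} (h : φ.coeff 0 = 1) :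
    (integralInv φ).coeff 1 = 1 := by
  rw [PowerSeries.coeff_zero_eq_constantCoeff_apply] at h
  simp [integralInv, h]

end Formal

/-! ### Convergence of the point transformation. -/

section Convergent

variable {K : Type*} [RCLike K]

/-- Each term is bounded by the sum of the series. Restricting to `n ≥ 1` lets the constant factor
be absorbed into the base. -/
theorem IsConvergent.exists_norm_mixedCoeffs_le {F : MvPowerSeries (Fin 3) K}
    (h : IsConvergent F) :
    ∃ M : ℝ, 1 ≤ M ∧ ∀ n, 1 ≤ n → ‖(mixedCoeffs F).coeff n‖ ≤ M ^ n := by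
  obtain ⟨ρ, hρ, hs⟩ := h
  set C := ∑' d : Fin 3 →₀ ℕ, ‖coeff d F‖ * ρ ^ d.degree with hC
  have hb : ∀ n, ‖(mixedCoeffs F).coeff n‖ * ρ ^ (n + 2) ≤ C := fun n => by
    have := hs.le_tsum (exponent n 1 1) fun d _ => by positivity
    rw [degree_exponent] at this
    rwa [mixedCoeffs, PowerSeries.coeff_mk]
  set A := max 1 (C / ρ ^ 2) with hA
  set B := max 1 ρ⁻¹ with hB
  have hA1 : 1 ≤ A := le_max_left _ _
  have hB1 : 1 ≤ B := le_max_left _ _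
  refine ⟨A * B, one_le_mul_of_one_le_of_one_le hA1 hB1, fun n hn => ?_⟩
  calc ‖(mixedCoeffs F).coeff n‖ ≤ C / ρ ^ (n + 2) := by
        rw [le_div_iff₀ (by positivity)]; exact hb n
    _ = C / ρ ^ 2 * ρ⁻¹ ^ n := by
        rw [pow_add, inv_pow]; field_simp
    _ ≤ A * B ^ n := by
        gcongr
        · exact le_max_right _ _
        · exact le_max_right _ _
    _ ≤ A ^ n * B ^ n := by
        gcongr
        exact le_self_pow₀ hA1 (by omega)
    _ = (A * B) ^ n := (mul_pow _ _ _).symm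

/-- The recursion for the inverse is bounded by ∑_{k<n} M^(n-k) (2M)^k = Mⁿ ∑_{k<n} 2^k ≤ (2M)ⁿ. -/
theorem norm_coeff_inv_le {φ : PowerSeries K} (h0 : φ.coeff 0 = 1) {M : ℝ} (hM : 0 ≤ M)
    (h : ∀ n, 1 ≤ n → ‖φ.coeff n‖ ≤ M ^ n) (n : ℕ) : ‖φ⁻¹.coeff n‖ ≤ (2 * M) ^ n := by
  rw [PowerSeries.coeff_zero_eq_constantCoeff_apply] at h0
  induction n using Nat.strong_induction_on with
  | _ n ih =>
    rw [PowerSeries.coeff_inv, h0]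
    by_cases hn : n = 0
    · simp [hn]
    · rw [if_neg hn, inv_one, neg_one_mul, norm_neg]
      refine (norm_sum_le _ _).trans ?_
      have geom : ∀ n : ℕ, ∑ k ∈ Finset.range n, (2 : ℝ) ^ k ≤ 2 ^ n := fun n => by
        induction n with
        | zero => simp
        | succ n ih => rw [Finset.sum_range_succ, pow_succ]; linarith
      rw [← Finset.Nat.sum_antidiagonal_swap, Finset.Nat.sum_antidiagonal_eq_sum_range_succ_mk,
        Finset.sum_range_succ]
      simp only [Prod.swap, lt_irrefl, if_false, norm_zero, add_zero]
      calc _ ≤ ∑ k ∈ Finset.range n, M ^ n * 2 ^ k := by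
            refine Finset.sum_le_sum fun k hk => ?_
            rw [Finset.mem_range] at hk
            rw [if_pos hk, norm_mul]
            calc _ ≤ M ^ (n - k) * (2 * M) ^ k := by
                  gcongr
                  · exact h _ (by omega)
                  · exact ih k hk
              _ = M ^ n * 2 ^ k := by
                  rw [mul_pow, mul_left_comm, ← pow_add, Nat.sub_add_cancel hk.le, mul_comm]
        _ ≤ M ^ n * 2 ^ n := by
            rw [← Finset.mul_sum]
            gcongr
            exact geom n
        _ = (2 * M) ^ n := by rw [mul_pow, mul_comm]

theorem isConvergent_of_norm_coeff_le {g : PowerSeries K} {R : ℝ} (hR : 0 < R)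
    (h : ∀ n, ‖g.coeff n‖ ≤ R ^ n) : IsConvergent g := by
  -- Half of the radius 1/R leaves a geometric series of ratio 1/2.
  refine ⟨(2 * R)⁻¹, by positivity, ?_⟩
  have hs : Summable fun d : Unit →₀ ℕ => (1 / 2 : ℝ) ^ (d ()) :=
    (Finsupp.uniqueEquiv (M := ℕ) ()).summable_iff.2 summable_geometric_two
  refine Summable.of_nonneg_of_le (fun d => by positivity) (fun d => ?_) hs
  have hd : d = Finsupp.single () (d ()) := by ext; simp
  have hdeg : d.degree = d () := by rw [hd]; simp
  have hc : ‖coeff d g‖ ≤ R ^ d () := by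
    have := h (d ())
    rwa [PowerSeries.coeff, ← hd] at this
  rw [hdeg]
  calc _ ≤ R ^ d () * (2 * R)⁻¹ ^ d () := by gcongr
    _ = (1 / 2) ^ d () := by
        rw [← mul_pow]
        congr 1
        field_simp

theorem isConvergent_integralInv {φ : PowerSeries K} (h0 : φ.coeff 0 = 1) {M : ℝ} (hM : 1 ≤ M)
    (h : ∀ n, 1 ≤ n → ‖φ.coeff n‖ ≤ M ^ n) : IsConvergent (integralInv φ) := by
  refine isConvergent_of_norm_coeff_le (R := 2 * M) (by linarith) fun n => ?_
  rw [integralInv, PowerSeries.coeff_mk]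
  rcases Nat.eq_zero_or_pos n with rfl | hn
  · simp
  · rw [norm_div, RCLike.norm_natCast]
    have hn1 : (1 : ℝ) ≤ n := by exact_mod_cast hn
    refine (div_le_self (norm_nonneg _) hn1).trans ?_
    refine (norm_coeff_inv_le h0 (by linarith) h _).trans ?_
    exact pow_le_pow_right₀ (by linarith) (Nat.sub_le _ _)

end Convergent

/-! ### Assembly of the theorem. -/

section Main

variable {K : Type*} [RCLike K]

/-- `g` is indexed by unordered pairs, whereas a map needs an ordered triple. On diagonal pairs the
choice is arbitrary. -/
theorem exists_representative (z : Sym2 (Fin 4)) : ∃ t : Fin 4 × Fin 4 × Fin 4,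
    ∀ i j, i ≠ j → s(i, j) = z → [t.1, t.2.1, t.2.2].Nodup ∧ s(t.1, t.2.1) = z := by
  induction z using Sym2.inductionOn with
  | _ i j =>
    by_cases hij : i = j
    · refine ⟨(i, i, i), fun a b hab h => absurd ?_ hab⟩
      subst hij
      rcases Sym2.eq_iff.1 h with ⟨rfl, rfl⟩ | ⟨rfl, rfl⟩ <;> rfl
    · obtain ⟨k, hk⟩ := exists_nodup_three hij
      exact ⟨(i, j, k), fun _ _ _ _ => ⟨hk, rfl⟩⟩

theorem exists_transforms_darbouxSystem {T : MapFamily K} (hT : IsNearIdentity T)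
    (hquad : HasNormalQuadraticPart T) (hcons : IsConsistent T) :
    ∃ g : Sym2 (Fin 4) → PowerSeries K, IsPointTransformation g ∧
      Transforms g T (darbouxSystem K) ∧
      ((∀ i j k, [i, j, k].Nodup → IsConvergent (T i j k)) →
        ∀ i j, i ≠ j → IsConvergent (g s(i, j))) := by
  choose t ht using exists_representative
  have hφ : ∀ i j, i ≠ j →
      (mixedCoeffs (T (t s(i, j)).1 (t s(i, j)).2.1 (t s(i, j)).2.2)).coeff 0 = 1 :=
    fun i j hij => coeff_zero_mixedCoeffs (hT.sub_quadratic_mem hquad (ht _ i j hij rfl).1)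
  have hg : IsPointTransformation fun z =>
      integralInv (mixedCoeffs (T (t z).1 (t z).2.1 (t z).2.2)) := fun i j hij =>
    ⟨coeff_zero_integralInv _, coeff_one_integralInv (hφ i j hij)⟩
  refine ⟨_, hg, transforms_darbouxSystem hT hquad hcons hg fun i j hij => ?_,
    fun hconv i j hij => ?_⟩
  · obtain ⟨hn, he⟩ := ht _ i j hij rfl
    refine ⟨_, _, _, hn, he, ?_⟩
    rw [he]
    exact derivative_integralInv_mul (hφ i j hij)
  · obtain ⟨M, hM, hb⟩ := (hconv _ _ _ (ht _ i j hij rfl).1).exists_norm_mixedCoeffs_le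
    exact isConvergent_integralInv (hφ i j hij) hM hb

end Main

end Darboux4D

end

theorem theorem1 {K : Type*} [RCLike K] (T : Darboux4D.MapFamily K)
    (hT : Darboux4D.IsNearIdentity T)
    (hquad : Darboux4D.HasNormalQuadraticPart T)
    (hcons : Darboux4D.IsConsistent T) :
    ∃ g : Sym2 (Fin 4) → PowerSeries K,
      Darboux4D.IsPointTransformation g ∧
      Darboux4D.Transforms g T (Darboux4D.darbouxSystem K) ∧
      ((∀ i j k, [i, j, k].Nodup → Darboux4D.IsConvergent (T i j k)) →
        ∀ i j, i ≠ j → Darboux4D.IsConvergent (g s(i, j))) := by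
  exact Darboux4D.exists_transforms_darbouxSystem hT hquad hcons
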